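/- Let $A$ be a $2\times 2$ integer matrix with $\det A=\pm1$ and no eigenvalue on the unit circle, let $\lambda>1$ be the absolute value of its expanding eigenvalue, and let $f_A(x)=Ax \bmod 1$ on $\mathbb T^2=\mathbb R^2/\mathbb Z^2$. Let $v^u,v^s$ be unit eigenvectors of $A^{T}$ for the eigenvalues outside and inside the unit circle, and $\mathcal C_u=\{a^uv^u+a^sv^s:|a^s|\le|a^u|\}$. For $\hat\varphi(k)=\int_{\mathbb T^2}\varphi(x)e^{-2\pi i k\cdot x}\,dx$, $k\in\mathbb Z^2$, put $$\|\varphi\|_{\mathcal H^p}^2=|\hat\varphi(0)|^2+\sum_{k\in\mathcal C_u\setminus\{0\}}|k|^{2p}|\hat\varphi(k)|^2+\sum_{k\notin\mathcal C_u}|k|^{-2p}|\hat\varphi(k)|^2,\qquad \|\varphi\|_{H^{s}}^2=\sum_{k\ne0}|k|^{2s}|\hat\varphi(k)|^2 ,$$ and let $\mathcal H^p_0$ be the completion of the mean-zero smooth functions $\mathbb T^2\to\mathbb C$ with respect to $\|\cdot\|_{\mathcal H^p}$. For a volume-preserving $C^\infty$ diffeomorphism $f$ of $\mathbb T^2$ and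 $\kappa\ge0$ let $\mathcal L_{f,\kappa}\varphi=e^{\kappa\Delta}(\varphi\circ f^{-1})$. Let $d_{C^0}$ be the uniform distance, $d_{C^k}(f,g)=\max\{d_{C^{k-1}}(f,g),\sup_x\|D^kf(x)-D^kg(x)\|\}$ for $k\ge1$, and $d_{C^\infty}=\sum_{k\ge0}2^{-k}\frac{d_{C^k}}{1+d_{C^k}}$. Let $p>0$. (a) For all $L>p$ and $\nu\in(1,\lambda)$ there are $\epsilon,C_2,C_3,M>0$ such that for all $\kappa\ge0$ and all volume-preserving $C^\infty$ diffeomorphisms $f$ of $\mathbb T^2$ with $d_{C^\infty}(f,f_A)<\epsilon$, the operator $\mathcal L_{f,\kappa}$ extends to a bounded linear operator on $\mathcal H^p_0$, and for all $n\ge1$ and $\varphi\in\mathcal H^p_0$ $$\|\mathcal L_{f,\kappa}^n\varphi\|_{\mathcal H^p}\le C_2\,\nu^{-np}\|\varphi\|_{\mathcal H^p}+C_3M^n\|\varphi\|_{H^{-L}} .$$ (b) There is an integer $r\ge0$ (depending only on $A$ and $p$) such that for all $L>p$, $\nu\in(1,\lambda)$ and $\hat C>0$ there are $\epsilon,C_2,C_3,M>0$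 for which the conclusion of (a) holds for all $\kappa\ge0$ and all volume-preserving $C^\infty$ diffeomorphisms $f$ of $\mathbb T^2$ with $d_{C^1}(f,f_A)<\epsilon$ and $d_{C^r}(f,\mathrm{Id})\le\hat C$. -/

import Mathlib

open scoped ContDiff Matrix
open MeasureTheory

noncomputable section

namespace PulsedDiffusion

/-! ### Hyperbolic integer matrices and the cone of expanding wavenumbers -/

/-- An integer matrix of determinant `±1` without (complex) eigenvalues on the unit circle. -/
def IsHyperbolic (A : Matrix (Fin 2) (Fin 2) ℤ) : Prop :=
  (A.det = 1 ∨ A.det = -1) ∧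
    ∀ μ : ℂ, Module.End.HasEigenvalue (Matrix.toLin' (A.map (Int.cast : ℤ → ℂ))) μ → ‖μ‖ ≠ 1

/-- `lam > 1` is the absolute value of the expanding eigenvalue of `A`. -/
def IsExpansionRate (A : Matrix (Fin 2) (Fin 2) ℤ) (lam : ℝ) : Prop :=
  1 < lam ∧ ∃ μ : ℝ,
    Module.End.HasEigenvalue (Matrix.toLin' (A.map (Int.cast : ℤ → ℝ))) μ ∧ |μ| = lam

/-- `v` is a Euclidean unit eigenvector of the transpose of `A` for the real eigenvalue `μ`. -/
def IsUnitEigenvectorTranspose (A : Matrix (Fin 2) (Fin 2) ℤ) (μ : ℝ) (v : Fin 2 → ℝ) : Prop :=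
  v ⬝ᵥ v = 1 ∧ (A.map (Int.cast : ℤ → ℝ))ᵀ *ᵥ v = μ • v

/-- The cone `C_u = {a_u v_u + a_s v_s : |a_s| ≤ |a_u|}`, where `v_u`, `v_s` are unit eigenvectors
of `Aᵀ` for the eigenvalues outside and inside the unit circle. For hyperbolic `A` these vectors are
unique up to sign, and the cone does not depend on the signs. -/
def unstableCone (A : Matrix (Fin 2) (Fin 2) ℤ) : Set (Fin 2 → ℝ) :=
  {w | ∃ (μu μs : ℝ) (vu vs : Fin 2 → ℝ),
    1 < |μu| ∧ IsUnitEigenvectorTranspose A μu vu ∧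
    |μs| < 1 ∧ IsUnitEigenvectorTranspose A μs vs ∧
    ∃ au as : ℝ, w = au • vu + as • vs ∧ |as| ≤ |au|}

/-! ### Smooth maps of the two-torus -/

/-- The Euclidean plane. -/
abbrev Plane : Type := EuclideanSpace ℝ (Fin 2)

/-- The torus `(ℝ / ℤ)²`. -/
abbrev Torus : Type := UnitAddTorus (Fin 2)

/-- The normalised Lebesgue (Haar) measure on the torus. -/
def torusVol : Measure Torus := Measure.pi fun _ => AddCircle.haarAddCircle

/-- The covering projection `ℝ² → (ℝ / ℤ)²`. -/
def proj (x : Plane) : Torus := fun i => ((x i : ℝ) : UnitAddCircle)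

/-- A `C^∞` map of the torus, together with a smooth lift to the plane. Every smooth map of the
torus has such a lift, and two lifts differ by a constant vector in `ℤ²`; in particular the
derivatives of the lift are those of the map. -/
structure TorusMap where
  toFun : Torus → Torus
  lift : Plane → Plane
  contDiff_lift : ContDiff ℝ ∞ lift
  proj_lift : ∀ x, toFun (proj x) = proj (lift x)

/-- A `C^∞` diffeomorphism of the torus. -/
structure TorusDiffeo extends TorusMap where
  inv : TorusMap
  left_inv : Function.LeftInverse inv.toFun toFun
  right_inv : Function.RightInverse inv.toFun toFun

/-- The identity map. -/
def idMap : TorusMap where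
  toFun := id
  lift := id
  contDiff_lift := contDiff_id
  proj_lift := fun _ => rfl

/-- The map `f_A(x) = A x mod 1`. -/
def catMap (A : Matrix (Fin 2) (Fin 2) ℤ) : TorusMap where
  toFun := fun x i => ∑ j, A i j • x j
  lift := fun x => Matrix.toEuclideanCLM (n := Fin 2) (𝕜 := ℝ) (A.map (Int.cast : ℤ → ℝ)) x
  contDiff_lift := ContinuousLinearMap.contDiff _
  proj_lift := by
    intro x
    funext i
    simp [proj, Matrix.mulVec, dotProduct, Fin.sum_univ_two]

/-- The Euclidean distance on the torus. -/
def torusDist (x y : Torus) : ℝ := Real.sqrt (∑ i, ‖x i - y i‖ ^ 2)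

/-- The `C^k` distance: `d_{C^0}` is the uniform distance, and `d_{C^k}` is the maximum of
`d_{C^{k-1}}` and `sup_x ‖D^k f(x) - D^k g(x)‖`. The suprema are finite, since the derivatives of
lifts are continuous and (from first order on) `ℤ²`-periodic. -/
def ckDist : ℕ → TorusMap → TorusMap → ℝ
  | 0, f, g => ⨆ x : Torus, torusDist (f.toFun x) (g.toFun x)
  | k + 1, f, g => max (ckDist k f g)
      (⨆ x : Plane, ‖iteratedFDeriv ℝ (k + 1) f.lift x - iteratedFDeriv ℝ (k + 1) g.lift x‖)

/-- The `C^∞` distance `∑ 2^{-k} d_{C^k} / (1 + d_{C^k})`. -/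
def cInfDist (f g : TorusMap) : ℝ :=
  ∑' k : ℕ, (2 : ℝ)⁻¹ ^ k * (ckDist k f g / (1 + ckDist k f g))

/-! ### The anisotropic space and the Sobolev norms -/

/-- The Euclidean length `|k|` of a wavenumber. -/
def waveNorm (k : Fin 2 → ℤ) : ℝ := Real.sqrt (∑ i, (k i : ℝ) ^ 2)

open Classical in
/-- The weight of the anisotropic norm: `1` at `k = 0`, `|k|^p` for `k ≠ 0` in the cone `C_u`, and
`|k|^{-p}` for `k ≠ 0` outside it. -/
def anisoWeight (A : Matrix (Fin 2) (Fin 2) ℤ) (p : ℝ) (k : Fin 2 → ℤ) : ℝ :=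
  if k = 0 then 1
  else if (fun i => (k i : ℝ)) ∈ unstableCone A then waveNorm k ^ p
  else waveNorm k ^ (-p)

/-- The mean-zero anisotropic space: the completion of the mean-zero smooth functions under
`‖·‖_{H^p}`, realised as the space of families of Fourier coefficients with vanishing zeroth
coefficient and finite weighted square sum. A smooth mean-zero function `φ` is the element
`UnitAddTorus.mFourierCoeff φ`; such elements are dense (trigonometric polynomials). -/
def HpZero (A : Matrix (Fin 2) (Fin 2) ℤ) (p : ℝ) : Submodule ℂ ((Fin 2 → ℤ) → ℂ) where
  carrier := {c | c 0 = 0 ∧ Summable fun k => (anisoWeight A p k * ‖c k‖) ^ 2}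
  zero_mem' := by simp [summable_zero]
  add_mem' := by
    rintro a b ⟨ha0, ha⟩ ⟨hb0, hb⟩
    refine ⟨by simp [ha0, hb0], ?_⟩
    refine Summable.of_nonneg_of_le (fun k => sq_nonneg _) (fun k => ?_)
      ((ha.mul_left 2).add (hb.mul_left 2))
    have h1 : ‖a k + b k‖ ^ 2 ≤ 2 * ‖a k‖ ^ 2 + 2 * ‖b k‖ ^ 2 := by
      have h := norm_add_le (a k) (b k)
      have h0 := norm_nonneg (a k + b k)
      nlinarith [sq_nonneg (‖a k‖ - ‖b k‖)]
    have h2 := mul_le_mul_of_nonneg_left h1 (sq_nonneg (anisoWeight A p k))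
    simp only [Pi.add_apply, mul_pow]
    linarith
  smul_mem' := by
    rintro z a ⟨ha0, ha⟩
    refine ⟨by simp [ha0], ?_⟩
    refine (ha.mul_left (‖z‖ ^ 2)).congr (fun k => ?_)
    simp only [Pi.smul_apply, smul_eq_mul, norm_mul]
    ring

/-- The anisotropic norm
`(|c_0|² + ∑_{k ∈ C_u, k ≠ 0} |k|^{2p} |c_k|² + ∑_{k ∉ C_u, k ≠ 0} |k|^{-2p} |c_k|²)^{1/2}`. -/
def anisoNorm (A : Matrix (Fin 2) (Fin 2) ℤ) (p : ℝ) (c : (Fin 2 → ℤ) → ℂ) : ℝ :=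
  Real.sqrt (∑' k, (anisoWeight A p k * ‖c k‖) ^ 2)

/-- The homogeneous Sobolev norm `(∑_{k ≠ 0} |k|^{2s} |c_k|²)^{1/2}`. -/
def sobolevNorm (s : ℝ) (c : (Fin 2 → ℤ) → ℂ) : ℝ :=
  Real.sqrt (∑' k, if k = 0 then 0 else (waveNorm k ^ s * ‖c k‖) ^ 2)

/-! ### Transfer operators with diffusion -/

/-- The transfer operator `φ ↦ φ ∘ f⁻¹`. -/
def transfer (f : TorusDiffeo) (φ : Torus → ℂ) : Torus → ℂ := fun x => φ (f.inv.toFun x)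

/-- The heat semigroup `e^{κ Δ}` on Fourier coefficients with respect to `e_k(x) = e^{2πi k·x}`,
for which `Δ e_k = -4π² |k|² e_k`. -/
def heat (κ : ℝ) (c : (Fin 2 → ℤ) → ℂ) : (Fin 2 → ℤ) → ℂ :=
  fun k => (Real.exp (-(κ * (4 * Real.pi ^ 2 * waveNorm k ^ 2))) : ℂ) * c k

/-- A function on the torus is smooth if its periodic lift to the plane is. -/
def IsSmooth (φ : Torus → ℂ) : Prop := ContDiff ℝ ∞ fun x : Plane => φ (proj x)

/-- `T` is the extension of `φ ↦ e^{κ Δ} (φ ∘ f⁻¹)` from mean-zero smooth functions to a bounded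
linear operator on the mean-zero anisotropic space (unique, by density). -/
def IsTransferExtension (A : Matrix (Fin 2) (Fin 2) ℤ) (p κ : ℝ) (f : TorusDiffeo)
    (T : Module.End ℂ (HpZero A p)) : Prop :=
  (∃ K : ℝ, ∀ c : HpZero A p, anisoNorm A p (T c) ≤ K * anisoNorm A p c) ∧
  ∀ (φ : Torus → ℂ) (c : HpZero A p), IsSmooth φ →
    (c : (Fin 2 → ℤ) → ℂ) = UnitAddTorus.mFourierCoeff φ →
    (T c : (Fin 2 → ℤ) → ℂ) = heat κ (UnitAddTorus.mFourierCoeff (transfer f φ))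

/-- The Lasota-Yorke inequality for the extension of `e^{κ Δ} ∘ L_f`:
`‖L^n φ‖_{H^p} ≤ C₂ ν^{-np} ‖φ‖_{H^p} + C₃ M^n ‖φ‖_{H^{-L}}` for all `n ≥ 1` and all mean-zero `φ`
in the anisotropic space. -/
def LasotaYorke (A : Matrix (Fin 2) (Fin 2) ℤ) (p L ν κ C₂ C₃ M : ℝ) (f : TorusDiffeo) : Prop :=
  ∃ T : Module.End ℂ (HpZero A p), IsTransferExtension A p κ f T ∧
    ∀ n : ℕ, 1 ≤ n → ∀ φ : HpZero A p,
      anisoNorm A p ((T ^ n) φ) ≤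
        C₂ * ν ^ (-((n : ℝ) * p)) * anisoNorm A p φ + C₃ * M ^ n * sobolevNorm (-L) φ

end PulsedDiffusion

end

noncomputable section
namespace PulsedDiffusion

/-! ### Periodic functions with bounded derivatives and oscillatory integrals -/

/-! In Fourier coefficients, composition with `f⁻¹` is the matrix `M k l = ∫ e_l · conj (e_k ∘ f)`,
and the estimate rests on three facts about it. Its phase `l·y - k·f(y)` has gradient `l - Df(y)ᵀ
k`, close to `l - Aᵀ k`. By non-stationary phase, `M k l` decays rapidly unless `l` lies within
`δ|k|` of `Aᵀ k` (`exists_norm_fourierMatrix_le`, `exists_far_entries_le`). On the remaining near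
pairs with `|k|` large, hyperbolicity of `Aᵀ` makes the squared weight at `k` at most `ν^{-2p}`
times that at `l`, once lengths are measured in eigencoordinates
(`EigenCoords.exists_weight_le_of_near`). Since `f` preserves volume, the functions `e_k ∘ f` are
orthonormal and `M` contracts `ℓ²` (`tsum_enorm_sq_fourierMatrix_le`). Many `l` are near a given
`k`, so the near part cannot be summed entry by entry without losing a constant. Instead the `ℓ²`
contraction is applied on each superlevel set of the weight and integrated over the level
(`energy_le_layercake`). This gives a one-step inequality with leading factor exactly `ν^{-2p}`,
which can be iterated, plus a remainder in a weak norm of fixed order `-(p+1)`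
(`exists_one_step_estimate`). Diffusion multiplies coefficients by numbers in `(0, 1]` and only
helps. After iteration, the weak norm is interpolated between the anisotropic norm and `H^{-L}`,
with a parameter geometric in `n` (`exists_norm_pow_le`). Thus `L` enters only after the dynamics,
and the number of derivatives of `f` that are used depends on `p` alone. -/

/-- `u` is `1`-periodic, and its derivatives up to order `n` are continuous and bounded by `B`. -/
def DerivBound : ℕ → ℝ → (ℝ → ℂ) → Prop
  | 0, B, u => Continuous u ∧ Function.Periodic u 1 ∧ ∀ t, ‖u t‖ ≤ B
  | n + 1, B, u => Function.Periodic u 1 ∧ (∀ t, ‖u t‖ ≤ B) ∧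
      ∃ u' : ℝ → ℂ, (∀ t, HasDerivAt u (u' t) t) ∧ DerivBound n B u'

namespace DerivBound

theorem periodic {n : ℕ} {B : ℝ} {u : ℝ → ℂ} (h : DerivBound n B u) : Function.Periodic u 1 := by
  cases n with
  | zero => exact h.2.1
  | succ n => exact h.1

theorem norm_le {n : ℕ} {B : ℝ} {u : ℝ → ℂ} (h : DerivBound n B u) (t : ℝ) : ‖u t‖ ≤ B := by
  cases n with
  | zero => exact h.2.2 t
  | succ n => exact h.2.1 t

theorem nonneg {n : ℕ} {B : ℝ} {u : ℝ → ℂ} (h : DerivBound n B u) : 0 ≤ B :=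
  (norm_nonneg _).trans (h.norm_le 0)

theorem continuous {n : ℕ} {B : ℝ} {u : ℝ → ℂ} (h : DerivBound n B u) : Continuous u := by
  cases n with
  | zero => exact h.1
  | succ n =>
    obtain ⟨_, _, u', hu', _⟩ := h
    exact continuous_iff_continuousAt.2 fun t => (hu' t).continuousAt

theorem mono {n : ℕ} {B B' : ℝ} (hB : B ≤ B') {u : ℝ → ℂ} (h : DerivBound n B u) :
    DerivBound n B' u := by
  induction n generalizing u with
  | zero => exact ⟨h.1, h.2.1, fun t => (h.2.2 t).trans hB⟩
  | succ n ih =>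
    obtain ⟨h1, h2, u', h3, h4⟩ := h
    exact ⟨h1, fun t => (h2 t).trans hB, u', h3, ih h4⟩

theorem of_succ {n : ℕ} {B : ℝ} {u : ℝ → ℂ} (h : DerivBound (n + 1) B u) : DerivBound n B u := by
  induction n generalizing u with
  | zero => exact ⟨h.continuous, h.1, h.2.1⟩
  | succ n ih =>
    obtain ⟨h1, h2, u', h3, h4⟩ := h
    exact ⟨h1, h2, u', h3, ih h4⟩

theorem add {n : ℕ} {B B' : ℝ} {u v : ℝ → ℂ} (hu : DerivBound n B u) (hv : DerivBound n B' v) :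
    DerivBound n (B + B') (fun t => u t + v t) := by
  induction n generalizing u v with
  | zero =>
    exact ⟨hu.1.add hv.1, hu.2.1.add hv.2.1,
      fun t => (norm_add_le _ _).trans (add_le_add (hu.2.2 t) (hv.2.2 t))⟩
  | succ n ih =>
    obtain ⟨h1, h2, u', h3, h4⟩ := hu
    obtain ⟨k1, k2, v', k3, k4⟩ := hv
    exact ⟨h1.add k1, fun t => (norm_add_le _ _).trans (add_le_add (h2 t) (k2 t)),
      _, fun t => (h3 t).add (k3 t), ih h4 k4⟩

/-- Each differentiation doubles the number of Leibniz terms, hence the crude factor `2 ^ n`. -/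
theorem mul {n : ℕ} {B B' : ℝ} {u v : ℝ → ℂ} (hu : DerivBound n B u) (hv : DerivBound n B' v) :
    DerivBound n (2 ^ n * (B * B')) (fun t => u t * v t) := by
  have hB := hu.nonneg
  have hB' := hv.nonneg
  have key : ∀ t, ‖u t * v t‖ ≤ B * B' := fun t => by
    rw [norm_mul]
    exact mul_le_mul (hu.norm_le t) (hv.norm_le t) (norm_nonneg _) hB
  have key' : ∀ t, ‖u t * v t‖ ≤ 2 ^ n * (B * B') := fun t =>
    (key t).trans (le_mul_of_one_le_left (by positivity) (one_le_pow₀ (by norm_num)))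
  induction n generalizing u v with
  | zero => exact ⟨hu.1.mul hv.1, hu.2.1.mul hv.2.1, key'⟩
  | succ n ih =>
    obtain ⟨h1, h2, u', h3, h4⟩ := id hu
    obtain ⟨k1, k2, v', k3, k4⟩ := id hv
    refine ⟨h1.mul k1, key', _, fun t => (h3 t).mul (k3 t), ?_⟩
    have aux : ∀ {a b : ℝ → ℂ}, DerivBound n B a → DerivBound n B' b →
        DerivBound n (2 ^ n * (B * B')) (fun t => a t * b t) := fun {a b} ha hb => by
      have : ∀ t, ‖a t * b t‖ ≤ B * B' := fun t => by
        rw [norm_mul]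
        exact mul_le_mul (ha.norm_le t) (hb.norm_le t) (norm_nonneg _) hB
      exact ih ha hb this fun t =>
        (this t).trans (le_mul_of_one_le_left (by positivity) (one_le_pow₀ (by norm_num)))
    exact (aux h4 hv.of_succ |>.add (aux hu.of_succ k4)).mono (by ring_nf; rfl)

theorem neg {n : ℕ} {B : ℝ} {u : ℝ → ℂ} (hu : DerivBound n B u) :
    DerivBound n B (fun t => -u t) := by
  induction n generalizing u with
  | zero => exact ⟨hu.1.neg, fun t => by simp [hu.2.1 t], fun t => by simpa using hu.2.2 t⟩
  | succ n ih =>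
    obtain ⟨h1, h2, u', h3, h4⟩ := hu
    exact ⟨fun t => by simp [h1 t], fun t => by simpa using h2 t, _, fun t => (h3 t).neg, ih h4⟩

theorem const (n : ℕ) (c : ℂ) : DerivBound n ‖c‖ fun _ => c := by
  have h0 : ∀ n : ℕ, DerivBound n ‖c‖ fun _ => (0 : ℂ) := fun n => by
    induction n with
    | zero => exact ⟨continuous_const, fun _ => rfl, fun _ => by simp⟩
    | succ n ih =>
      exact ⟨fun _ => rfl, fun _ => by simp, _, fun t => hasDerivAt_const t (0 : ℂ), ih⟩
  cases n with
  | zero => exact ⟨continuous_const, fun _ => rfl, fun _ => le_rfl⟩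
  | succ n => exact ⟨fun _ => rfl, fun _ => le_rfl, _, fun t => hasDerivAt_const t c, h0 n⟩

/-- Induction through `(1/q)' = -q' (1/q)²`. The resulting bound depends on `n` and `C` only, not on
`q`. -/
theorem exists_inv (n : ℕ) (C : ℝ) : ∃ G : ℝ, ∀ q : ℝ → ℂ, DerivBound n C q →
    (∀ t, 1 / 2 ≤ ‖q t‖) → DerivBound n G fun t => (q t)⁻¹ := by
  have hle : ∀ q : ℝ → ℂ, (∀ t, 1 / 2 ≤ ‖q t‖) → ∀ t, ‖(q t)⁻¹‖ ≤ 2 := fun q hq t => by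
    rw [norm_inv, inv_le_comm₀ (lt_of_lt_of_le (by norm_num) (hq t)) (by norm_num)]
    simpa using hq t
  have hne : ∀ q : ℝ → ℂ, (∀ t, 1 / 2 ≤ ‖q t‖) → ∀ t, q t ≠ 0 := fun q hq t h => by
    have := hq t
    rw [h] at this
    norm_num at this
  induction n with
  | zero =>
    exact ⟨2, fun q h hq => ⟨h.1.inv₀ (hne q hq), fun t => by simp [h.2.1 t], hle q hq⟩⟩
  | succ n ih =>
    obtain ⟨G, hG⟩ := ih
    refine ⟨max 2 (2 ^ n * (C * (2 ^ n * (G * G)))), fun q h hq => ?_⟩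
    have hg := hG q h.of_succ hq
    obtain ⟨h1, h2, q', h3, h4⟩ := h
    refine ⟨fun t => by simp [h1 t], fun t => (hle q hq t).trans (le_max_left _ _),
      fun t => -(q' t * ((q t)⁻¹ * (q t)⁻¹)), fun t => ?_,
      ((h4.mul (hg.mul hg)).neg).mono (le_max_right _ _)⟩
    have h5 := (h3 t).fun_inv (hne q hq t)
    rwa [show -q' t / q t ^ 2 = -(q' t * ((q t)⁻¹ * (q t)⁻¹)) by
      simp only [div_eq_mul_inv, sq, mul_inv]; ring] at h5

end DerivBound

/-- Repeated integration by parts against a periodic function `e` with `e' = Λ q e`, where `q` is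
bounded away from zero. -/
theorem exists_norm_oscillatory_integral_le (n : ℕ) (C B : ℝ) : ∃ K : ℝ, 0 ≤ K ∧
    ∀ (Λ : ℝ) (q e u : ℝ → ℂ), 0 < Λ → DerivBound n C q → (∀ t, 1 / 2 ≤ ‖q t‖) →
      (∀ t, HasDerivAt e (Λ * q t * e t) t) → Function.Periodic e 1 → (∀ t, ‖e t‖ ≤ 1) →
      DerivBound n B u → ‖∫ t in (0 : ℝ)..1, u t * e t‖ ≤ K * Λ⁻¹ ^ n := by
  -- Integration by parts replaces the amplitude `u` by `(u/q)'`, so the bound `B` has to vary along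
  -- the induction.
  induction n generalizing B with
  | zero =>
    refine ⟨max B 0, le_max_right _ _, fun Λ q e u hΛ hq hq2 he hep he1 hu => ?_⟩
    refine (intervalIntegral.norm_integral_le_of_norm_le_const (C := max B 0) fun t _ => ?_).trans
      (by simp)
    rw [norm_mul]
    exact (mul_le_of_le_one_right (norm_nonneg _) (he1 t)).trans
      ((hu.norm_le t).trans (le_max_left _ _))
  | succ n ih =>
    obtain ⟨G, hG⟩ := DerivBound.exists_inv (n + 1) C
    obtain ⟨K, hK, hI⟩ := ih (2 ^ (n + 1) * (B * G))
    refine ⟨K, hK, fun Λ q e u hΛ hq hq2 he hep he1 hu => ?_⟩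
    have hv := hu.mul (hG q hq hq2)
    obtain ⟨hv1, -, v', hv3, hv4⟩ := id hv
    have hq0 : ∀ t, q t ≠ 0 := fun t h => by
      have := hq2 t
      rw [h] at this
      norm_num at this
    have hec : Continuous e := continuous_iff_continuousAt.2 fun t => (he t).continuousAt
    have hparts := intervalIntegral.integral_mul_deriv_eq_deriv_mul (a := 0) (b := 1)
      (fun t _ => hv3 t) (fun t _ => he t) (hv4.continuous.intervalIntegrable _ _)
      (((continuous_const.mul hq.continuous).mul hec).intervalIntegrable _ _)
    -- Periodicity cancels the boundary terms.
    have hb : u 1 * (q 1)⁻¹ * e 1 - u 0 * (q 0)⁻¹ * e 0 = 0 := by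
      have h1 := hv1 0
      have h2 := hep 0
      simp only [zero_add] at h1 h2
      rw [h1, h2, sub_self]
    have heq : ∫ t in (0 : ℝ)..1, u t * e t = -((Λ : ℂ)⁻¹ * ∫ t in (0 : ℝ)..1, v' t * e t) := by
      have hΛ' : (Λ : ℂ) ≠ 0 := by exact_mod_cast hΛ.ne'
      have : ∫ t in (0 : ℝ)..1, u t * e t =
          (Λ : ℂ)⁻¹ * ∫ t in (0 : ℝ)..1, u t * (q t)⁻¹ * (Λ * q t * e t) := by
        rw [← intervalIntegral.integral_const_mul]
        congr 1
        funext t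
        field_simp [hq0 t]
      rw [this, hparts, hb]
      ring
    rw [heq, norm_neg, norm_mul, norm_inv, Complex.norm_real, Real.norm_of_nonneg hΛ.le]
    have := hI Λ q e v' hΛ hq.of_succ hq2 he hep he1 hv4
    calc Λ⁻¹ * _ ≤ Λ⁻¹ * (K * Λ⁻¹ ^ n) := by gcongr
      _ = _ := by ring

end PulsedDiffusion
end

noncomputable section
namespace PulsedDiffusion

/-! ### Lifts of smooth torus maps -/

theorem isOpenQuotientMap_proj : IsOpenQuotientMap proj := by
  have h : IsOpenQuotientMap
      (Pi.map (fun _ : Fin 2 => ((↑) : ℝ → UnitAddCircle))) :=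
    IsOpenQuotientMap.piMap fun _ => QuotientAddGroup.isOpenQuotientMap_mk
  exact h.comp (EuclideanSpace.equiv (Fin 2) ℝ).toHomeomorph.isOpenQuotientMap

theorem continuous_proj : Continuous proj := isOpenQuotientMap_proj.continuous

theorem proj_surjective : Function.Surjective proj := isOpenQuotientMap_proj.surjective

theorem proj_add (x y : Plane) : proj (x + y) = proj x + proj y := by
  funext i
  simp [proj]

theorem TorusMap.continuous_toFun (f : TorusMap) : Continuous f.toFun := by
  rw [isOpenQuotientMap_proj.isQuotientMap.continuous_iff]
  have : f.toFun ∘ proj = proj ∘ f.lift := funext f.proj_lift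
  rw [this]
  exact continuous_proj.comp f.contDiff_lift.continuous

theorem IsSmooth.continuous {φ : Torus → ℂ} (hφ : IsSmooth φ) : Continuous φ := by
  rw [isOpenQuotientMap_proj.isQuotientMap.continuous_iff]
  exact ContDiff.continuous hφ

/-- The increment of the lift under a period is continuous with integer coordinates, and the plane
is connected. Hence the derivatives of the lift from first order on are periodic. -/
theorem TorusMap.exists_lift_add (f : TorusMap) {v : Plane} (hv : proj v = 0) :
    ∃ c : Plane, ∀ x, f.lift (x + v) = f.lift x + c := by
  refine ⟨f.lift (0 + v) - f.lift 0, fun x => ?_⟩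
  have key : ∀ i, f.lift (x + v) i - f.lift x i = f.lift (0 + v) i - f.lift 0 i := fun i => by
    have hc : Continuous fun x => f.lift (x + v) i - f.lift x i := by
      have := f.contDiff_lift.continuous
      fun_prop
    have hm : Set.MapsTo (fun x => f.lift (x + v) i - f.lift x i) Set.univ
        (Set.range ((↑) : ℤ → ℝ)) := fun x _ => by
      have h : proj (f.lift (x + v)) = proj (f.lift x) := by
        rw [← f.proj_lift, ← f.proj_lift, proj_add, hv, add_zero]
      have h' : ((f.lift (x + v) i - f.lift x i : ℝ) : UnitAddCircle) = 0 := by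
        rw [AddCircle.coe_sub, sub_eq_zero]
        exact congrFun h i
      obtain ⟨n, hn⟩ := (AddCircle.coe_eq_zero_iff 1).1 h'
      exact ⟨n, by simpa using hn⟩
    have hd : IsDiscrete (Set.range ((↑) : ℤ → ℝ)) := by
      have := Int.isClosedEmbedding_coe_real.isEmbedding
      exact ⟨this.toHomeomorph.symm.isEmbedding.discreteTopology⟩
    obtain ⟨y, -, hy⟩ := isPreconnected_univ.eqOn_const_of_mapsTo hd hc.continuousOn hm
      ⟨0, 0, by simp⟩
    exact (hy (Set.mem_univ x)).trans (hy (Set.mem_univ 0)).symm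
  ext i
  have := key i
  simp only [PiLp.add_apply, PiLp.sub_apply]
  linarith

theorem TorusMap.iteratedFDeriv_lift_add (f : TorusMap) {v : Plane} (hv : proj v = 0) (n : ℕ)
    (x : Plane) :
    iteratedFDeriv ℝ (n + 1) f.lift (x + v) = iteratedFDeriv ℝ (n + 1) f.lift x := by
  obtain ⟨c, hc⟩ := f.exists_lift_add hv
  rw [← iteratedFDeriv_comp_add_right, show (fun y => f.lift (y + v)) = f.lift + fun _ => c from
    funext hc, iteratedFDeriv_add_apply (f.contDiff_lift.of_le (by exact_mod_cast le_top)).contDiffAt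
      contDiffAt_const, iteratedFDeriv_succ_const]
  simp

/-- Every point is moved by a period into a fixed compact ball, which turns periodicity into uniform
bounds. -/
theorem exists_proj_eq_zero_norm_add_le (x : Plane) :
    ∃ v : Plane, proj v = 0 ∧ ‖x + v‖ ≤ 2 := by
  refine ⟨WithLp.toLp 2 fun i => -(⌊x i⌋ : ℝ), ?_, ?_⟩
  · funext i
    rw [proj, Pi.zero_apply, AddCircle.coe_eq_zero_iff]
    exact ⟨-⌊x i⌋, by simp⟩
  · rw [EuclideanSpace.norm_eq, Real.sqrt_le_left (by norm_num)]
    have h : ∀ i, ‖(x + WithLp.toLp 2 fun i => -(⌊x i⌋ : ℝ)) i‖ ^ 2 ≤ 1 := fun i => by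
      have h0 := Int.fract_nonneg (x i)
      have h1 := (Int.fract_lt_one (x i)).le
      have : (x + WithLp.toLp 2 fun i => -(⌊x i⌋ : ℝ)) i = Int.fract (x i) := by
        simp [Int.fract, sub_eq_add_neg]
      rw [this, Real.norm_of_nonneg h0]
      nlinarith
    rw [Fin.sum_univ_two]
    linarith [h 0, h 1]

theorem TorusMap.exists_norm_iteratedFDeriv_lift_le (f : TorusMap) (n : ℕ) :
    ∃ B : ℝ, ∀ x, ‖iteratedFDeriv ℝ (n + 1) f.lift x‖ ≤ B := by
  have hc : Continuous (iteratedFDeriv ℝ (n + 1) f.lift) :=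
    f.contDiff_lift.continuous_iteratedFDeriv (by exact_mod_cast le_top)
  obtain ⟨B, hB⟩ := (isCompact_closedBall (0 : Plane) 2).exists_bound_of_continuousOn
    hc.continuousOn
  refine ⟨B, fun x => ?_⟩
  obtain ⟨v, hv, hx⟩ := exists_proj_eq_zero_norm_add_le x
  rw [← f.iteratedFDeriv_lift_add hv]
  exact hB _ (by simpa using hx)

/-- The supremum in `ckDist` dominates its terms only because periodicity makes the derivatives
bounded; an unbounded real supremum would be `0`. -/
theorem norm_iteratedFDeriv_sub_le_ckDist (f g : TorusMap) {j k : ℕ} (hj : 1 ≤ j) (hjk : j ≤ k)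
    (x : Plane) :
    ‖iteratedFDeriv ℝ j f.lift x - iteratedFDeriv ℝ j g.lift x‖ ≤ ckDist k f g := by
  induction k with
  | zero => omega
  | succ k ih =>
    rw [ckDist]
    rcases Nat.lt_or_ge k j with h | h
    · obtain rfl : j = k + 1 := by omega
      refine le_trans ?_ (le_max_right _ _)
      obtain ⟨B, hB⟩ := f.exists_norm_iteratedFDeriv_lift_le k
      obtain ⟨B', hB'⟩ := g.exists_norm_iteratedFDeriv_lift_le k
      refine le_ciSup (f := fun x => ‖iteratedFDeriv ℝ (k + 1) f.lift x -
        iteratedFDeriv ℝ (k + 1) g.lift x‖) ⟨B + B', ?_⟩ x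
      rintro _ ⟨y, rfl⟩
      exact (norm_sub_le _ _).trans (add_le_add (hB y) (hB' y))
    · exact (ih h).trans (le_max_left _ _)

theorem ckDist_nonneg (k : ℕ) (f g : TorusMap) : 0 ≤ ckDist k f g := by
  induction k with
  | zero => exact Real.iSup_nonneg fun x => Real.sqrt_nonneg _
  | succ k ih => exact ih.trans (le_max_left _ _)

/-- A single term of the series is at most the sum, and `t ↦ t / (1 + t)` is increasing. -/
theorem ckDist_lt_of_cInfDist_lt (k : ℕ) {δ : ℝ} (hδ : 0 < δ) {f g : TorusMap}
    (h : cInfDist f g < (2 : ℝ)⁻¹ ^ k * (δ / (1 + δ))) : ckDist k f g < δ := by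
  by_contra! hd
  refine absurd h (not_lt.2 ?_)
  have hnn : ∀ j, 0 ≤ (2 : ℝ)⁻¹ ^ j * (ckDist j f g / (1 + ckDist j f g)) := fun j => by
    have := ckDist_nonneg j f g
    positivity
  have hs : Summable fun j : ℕ => (2 : ℝ)⁻¹ ^ j * (ckDist j f g / (1 + ckDist j f g)) := by
    refine Summable.of_nonneg_of_le hnn (fun j => ?_)
      (summable_geometric_of_lt_one (r := (2 : ℝ)⁻¹) (by norm_num) (by norm_num))
    have := ckDist_nonneg j f g
    exact mul_le_of_le_one_right (by positivity) ((div_le_one (by positivity)).2 (by linarith))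
  refine le_trans ?_ (hs.le_tsum k fun j _ => hnn j)
  refine mul_le_mul_of_nonneg_left ?_ (by positivity)
  have := ckDist_nonneg k f g
  rw [div_le_div_iff₀ (by positivity) (by positivity)]
  nlinarith

/-- The `j`-th derivative of the lift along the line `t ↦ y + t v`. -/
def TorusMap.lineDeriv (f : TorusMap) (v y : Plane) (j : ℕ) (t : ℝ) : Plane :=
  iteratedFDeriv ℝ j f.lift (y + t • v) fun _ => v

theorem TorusMap.hasDerivAt_lineDeriv (f : TorusMap) (v y : Plane) (j : ℕ) (t : ℝ) :
    HasDerivAt (f.lineDeriv v y j) (f.lineDeriv v y (j + 1) t) t := by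
  have h1 : HasDerivAt (fun t : ℝ => y + t • v) v t := by
    simpa using ((hasDerivAt_id t).smul_const v).const_add y
  have h2 : DifferentiableAt ℝ (iteratedFDeriv ℝ j f.lift) (y + t • v) :=
    (f.contDiff_lift.differentiable_iteratedFDeriv (by exact_mod_cast ENat.natCast_lt_top j)) _
  have h3 := (h2.hasFDerivAt.comp_hasDerivAt t h1)
  have h4 := ((ContinuousMultilinearMap.apply ℝ (fun _ : Fin j => Plane) Plane
    fun _ => v).hasFDerivAt.comp_hasDerivAt t h3)
  rw [TorusMap.lineDeriv, iteratedFDeriv_succ_apply_left]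
  exact h4

theorem TorusMap.norm_lineDeriv_le (f : TorusMap) {v y : Plane} (hv : ‖v‖ = 1) {j : ℕ} {B : ℝ}
    (hB : ∀ x, ‖iteratedFDeriv ℝ j f.lift x‖ ≤ B) (t : ℝ) : ‖f.lineDeriv v y j t‖ ≤ B := by
  refine ((iteratedFDeriv ℝ j f.lift (y + t • v)).le_opNorm _).trans ?_
  simpa [hv] using hB (y + t • v)

theorem TorusMap.periodic_lineDeriv (f : TorusMap) {v : Plane} (hv : proj v = 0) (y : Plane)
    (j : ℕ) : Function.Periodic (f.lineDeriv v y (j + 1)) 1 := fun t => by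
  rw [TorusMap.lineDeriv, TorusMap.lineDeriv, add_smul, one_smul, ← add_assoc,
    f.iteratedFDeriv_lift_add hv]

end PulsedDiffusion
end

noncomputable section
namespace PulsedDiffusion
open UnitAddTorus ComplexConjugate

/-! ### The Fourier matrix of the transfer operator -/

instance : IsProbabilityMeasure torusVol :=
  inferInstanceAs (IsProbabilityMeasure (Measure.pi fun _ => AddCircle.haarAddCircle))

instance : torusVol.IsAddLeftInvariant :=
  inferInstanceAs (Measure.IsAddLeftInvariant (Measure.pi fun _ => AddCircle.haarAddCircle))

/-- The Hilbert basis of exponentials in `L²` of the torus. -/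
def torusBasis : HilbertBasis (Fin 2 → ℤ) ℂ (Lp ℂ 2 torusVol) := mFourierBasis

theorem torusBasis_apply (l : Fin 2 → ℤ) :
    torusBasis l = ContinuousMap.toLp (E := ℂ) 2 torusVol ℂ (mFourier l) :=
  congrFun (coe_mFourierBasis (d := Fin 2)) l

theorem mFourierCoeff_eq (φ : Torus → ℂ) (k : Fin 2 → ℤ) :
    mFourierCoeff φ k = ∫ y, mFourier (-k) y * φ y ∂torusVol := rfl

/-- The exponential `e_k` composed with a torus map. -/
def expComp (f : TorusMap) (k : Fin 2 → ℤ) : C(Torus, ℂ) :=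
  (mFourier k).comp ⟨f.toFun, f.continuous_toFun⟩

theorem expComp_apply (f : TorusMap) (k : Fin 2 → ℤ) (y : Torus) :
    expComp f k y = mFourier k (f.toFun y) := rfl

/-- The matrix of `φ ↦ φ ∘ f⁻¹` in the basis of exponentials, for volume-preserving `f`. -/
def fourierMatrix (f : TorusMap) (k l : Fin 2 → ℤ) : ℂ :=
  ∫ y, mFourier l y * conj (expComp f k y) ∂torusVol

theorem norm_mFourier_apply_le (k : Fin 2 → ℤ) (y : Torus) : ‖mFourier k y‖ ≤ 1 :=
  ((mFourier k).norm_coe_le_norm y).trans mFourier_norm.le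

theorem norm_fourierMatrix_le_one (f : TorusMap) (k l : Fin 2 → ℤ) :
    ‖fourierMatrix f k l‖ ≤ 1 := by
  have := norm_integral_le_of_norm_le_const (μ := torusVol) (C := 1)
    (f := fun y => mFourier l y * conj (expComp f k y)) (Filter.Eventually.of_forall fun y => by
      rw [norm_mul, RCLike.norm_conj]
      exact mul_le_one₀ (norm_mFourier_apply_le _ _) (norm_nonneg _) (norm_mFourier_apply_le _ _))
  simpa [fourierMatrix] using this

theorem inner_expComp_torusBasis (f : TorusMap) (k l : Fin 2 → ℤ) :
    inner ℂ (ContinuousMap.toLp (E := ℂ) 2 torusVol ℂ (expComp f k)) (torusBasis l) =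
      fourierMatrix f k l := by
  rw [torusBasis_apply, ContinuousMap.inner_toLp]
  rfl

/-- Volume preservation carries the inner products of the `e_k ∘ f` to those of the `e_k`; this
gives the `ℓ²` contraction below. -/
theorem orthonormal_expComp {f : TorusMap}
    (hf : MeasurePreserving f.toFun torusVol torusVol) :
    Orthonormal ℂ fun k => ContinuousMap.toLp (E := ℂ) 2 torusVol ℂ (expComp f k) := by
  have h := torusBasis.orthonormal
  rw [orthonormal_iff_ite] at h ⊢
  intro k l
  rw [← h k l, torusBasis_apply, torusBasis_apply, ContinuousMap.inner_toLp,
    ContinuousMap.inner_toLp]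
  conv_rhs => rw [← hf.map_eq]
  rw [integral_map hf.measurable.aemeasurable
    (Continuous.aestronglyMeasurable (by fun_prop))]
  rfl

/-- Composition preserves the mean: the zeroth row sees only the zeroth coefficient. -/
theorem fourierMatrix_zero_left (f : TorusMap) {l : Fin 2 → ℤ} (hl : l ≠ 0) :
    fourierMatrix f 0 l = 0 := by
  have h := orthonormal_iff_ite.1 torusBasis.orthonormal 0 l
  rw [if_neg hl.symm, torusBasis_apply, torusBasis_apply, ContinuousMap.inner_toLp] at h
  rw [← h, fourierMatrix]
  simp [expComp_apply, mFourier_zero]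

theorem hasSum_fourierMatrix_mul_inner (f : TorusMap) (k : Fin 2 → ℤ) (φ : Lp ℂ 2 torusVol) :
    HasSum (fun l => fourierMatrix f k l * inner ℂ (torusBasis l) φ)
      (inner ℂ (ContinuousMap.toLp (E := ℂ) 2 torusVol ℂ (expComp f k)) φ) := by
  simpa only [inner_expComp_torusBasis] using torusBasis.hasSum_inner_mul_inner
    (ContinuousMap.toLp (E := ℂ) 2 torusVol ℂ (expComp f k)) φ

/-- The Fourier matrix of a volume-preserving map is a contraction of `ℓ²`. -/
theorem tsum_enorm_sq_fourierMatrix_le {f : TorusMap}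
    (hf : MeasurePreserving f.toFun torusVol torusVol) (d : (Fin 2 → ℤ) → ℂ) :
    ∑' k, ‖∑' l, fourierMatrix f k l * d l‖ₑ ^ 2 ≤ ∑' l, ‖d l‖ₑ ^ 2 := by
  by_cases htop : ∑' l, ‖d l‖ₑ ^ 2 = ⊤
  · rw [htop]
    exact le_top
  have he : ∀ z : ℂ, ‖z‖ₑ ^ 2 = ENNReal.ofReal (‖z‖ ^ 2) := fun z => by
    rw [ENNReal.ofReal_pow (norm_nonneg _), ofReal_norm]
  have hs : Summable fun l => ‖d l‖ ^ 2 := by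
    simp only [he] at htop
    have := ENNReal.summable_toReal htop
    simpa [ENNReal.toReal_ofReal, sq_nonneg] using this
  have hmem : Memℓp d 2 := memℓp_gen (by simpa using hs)
  set D : lp (fun _ : Fin 2 → ℤ => ℂ) 2 := ⟨d, hmem⟩ with hD
  set φ := torusBasis.repr.symm D with hφ
  have hin : ∀ l, inner ℂ (torusBasis l) φ = d l := fun l => by
    rw [← torusBasis.repr_apply_apply, hφ, LinearIsometryEquiv.apply_symm_apply]
  have hsum : ∀ k, ∑' l, fourierMatrix f k l * d l =
      inner ℂ (ContinuousMap.toLp (E := ℂ) 2 torusVol ℂ (expComp f k)) φ := fun k => by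
    have := (hasSum_fourierMatrix_mul_inner f k φ).tsum_eq
    simpa only [hin] using this
  have hnorm : ‖φ‖ ^ 2 = ∑' l, ‖d l‖ ^ 2 := by
    rw [hφ, LinearIsometryEquiv.norm_map]
    have := lp.norm_rpow_eq_tsum (p := 2) (by norm_num) D
    simpa using this
  have hR : ∑' l, ‖d l‖ₑ ^ 2 = ENNReal.ofReal (‖φ‖ ^ 2) := by
    rw [hnorm, ENNReal.ofReal_tsum_of_nonneg (fun l => sq_nonneg _) hs]
    simp only [he]
  rw [hR, ENNReal.tsum_eq_iSup_sum]
  refine iSup_le fun s => ?_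
  simp only [he, hsum]
  rw [← ENNReal.ofReal_sum_of_nonneg fun _ _ => sq_nonneg _]
  -- Bessel's inequality for the orthonormal family `e_k ∘ f`.
  exact ENNReal.ofReal_le_ofReal ((orthonormal_expComp hf).sum_inner_products_le φ)

/-- The Fourier coefficients of `φ ∘ f⁻¹`. -/
theorem hasSum_fourierMatrix_mul_mFourierCoeff {f : TorusDiffeo}
    (hf : MeasurePreserving f.toFun torusVol torusVol) {φ : Torus → ℂ} (hφ : Continuous φ)
    (k : Fin 2 → ℤ) :
    HasSum (fun l => fourierMatrix f.toTorusMap k l * mFourierCoeff φ l)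
      (mFourierCoeff (transfer f φ) k) := by
  have h := hasSum_fourierMatrix_mul_inner f.toTorusMap k
    (ContinuousMap.toLp (E := ℂ) 2 torusVol ℂ ⟨φ, hφ⟩)
  have h1 : ∀ l, inner ℂ (torusBasis l) (ContinuousMap.toLp (E := ℂ) 2 torusVol ℂ ⟨φ, hφ⟩) =
      mFourierCoeff φ l := fun l => by
    rw [torusBasis_apply, ContinuousMap.inner_toLp, mFourierCoeff_eq]
    congr 1
    funext y
    rw [mFourier_neg, mul_comm]
    rfl
  have h2 : inner ℂ (ContinuousMap.toLp (E := ℂ) 2 torusVol ℂ (expComp f.toTorusMap k))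
      (ContinuousMap.toLp (E := ℂ) 2 torusVol ℂ ⟨φ, hφ⟩) = mFourierCoeff (transfer f φ) k := by
    rw [ContinuousMap.inner_toLp, mFourierCoeff_eq]
    have hinv := f.inv.continuous_toFun
    -- Substituting `x = f(y)` moves the composition from `φ` to the exponential.
    conv_rhs => rw [← hf.map_eq]
    rw [integral_map hf.measurable.aemeasurable
      (Continuous.aestronglyMeasurable (by unfold transfer; fun_prop))]
    congr 1
    funext y
    rw [mFourier_neg, mul_comm, transfer, f.left_inv y]
    rfl
  rw [h2] at h
  simpa only [h1] using h

end PulsedDiffusion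
end

noncomputable section
namespace PulsedDiffusion
open UnitAddTorus ComplexConjugate

/-! ### Decay of the Fourier matrix away from the graph of the linear map -/

/-- By translation invariance `G` may be replaced by its average along the segment `t ↦ t v`. This
reduces non-stationary phase on the torus to one variable. -/
theorem integral_torus_eq_integral_line {G : Torus → ℂ} (hG : Continuous G) (v : Plane) :
    ∫ y, G y ∂torusVol = ∫ y, (∫ t in (0 : ℝ)..1, G (proj (t • v) + y)) ∂torusVol := by
  have hc : Continuous (Function.uncurry fun (t : ℝ) (y : Torus) => G (proj (t • v) + y)) := by
    have := continuous_proj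
    unfold Function.uncurry
    fun_prop
  have hI : Integrable (Function.uncurry fun (t : ℝ) (y : Torus) => G (proj (t • v) + y))
      ((volume.restrict (Set.uIoc (0 : ℝ) 1)).prod torusVol) := by
    have : IsFiniteMeasure (volume.restrict (Set.uIoc (0 : ℝ) 1)) := by
      rw [Set.uIoc_of_le zero_le_one]
      infer_instance
    obtain ⟨C, hC⟩ := (isCompact_univ (X := Torus)).exists_bound_of_continuousOn hG.continuousOn
    exact Integrable.of_bound hc.aestronglyMeasurable C
      (Filter.Eventually.of_forall fun z => hC _ (Set.mem_univ _))
  rw [← intervalIntegral_integral_swap hI]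
  simp only [integral_add_left_eq_self G]
  simp

theorem mFourier_proj (l : Fin 2 → ℤ) (x : Plane) :
    mFourier l (proj x) =
      Complex.exp (2 * Real.pi * Complex.I * ((l 0 * x 0 + l 1 * x 1 : ℝ) : ℂ)) := by
  simp only [mFourier, proj, ContinuousMap.coe_mk, fourier_coe_apply, Fin.prod_univ_two,
    ← Complex.exp_add]
  congr 1
  push_cast
  ring

/-- Controls the derivatives of `c · ∂_v f` along a closed line; the `2` counts the coordinates.
Starting from order `m + 1 ≥ 1` is what makes the function periodic. -/
theorem derivBound_lineDeriv (f : TorusMap) {v : Plane} (hv : proj v = 0) (hv1 : ‖v‖ = 1)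
    (y : Plane) {K b : ℝ} {c : Fin 2 → ℝ} (hc : ∀ i, |c i| ≤ b) (n m : ℕ)
    (hK : ∀ j, m + 1 ≤ j → j ≤ m + 1 + n → ∀ x, ‖iteratedFDeriv ℝ j f.lift x‖ ≤ K) :
    DerivBound n (2 * b * K) fun t =>
      ((c 0 * f.lineDeriv v y (m + 1) t 0 + c 1 * f.lineDeriv v y (m + 1) t 1 : ℝ) : ℂ) := by
  have hd : ∀ (j : ℕ) (t : ℝ), HasDerivAt (fun t =>
      ((c 0 * f.lineDeriv v y j t 0 + c 1 * f.lineDeriv v y j t 1 : ℝ) : ℂ))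
      ((c 0 * f.lineDeriv v y (j + 1) t 0 + c 1 * f.lineDeriv v y (j + 1) t 1 : ℝ) : ℂ) t :=
    fun j t => by
      have h := f.hasDerivAt_lineDeriv v y j t
      have hi : ∀ i, HasDerivAt (fun t => f.lineDeriv v y j t i) (f.lineDeriv v y (j + 1) t i) t :=
        fun i => (EuclideanSpace.proj (𝕜 := ℝ) i).hasFDerivAt.comp_hasDerivAt t h
      exact (((hi 0).const_mul _).add ((hi 1).const_mul _)).ofReal_comp
  have hp : ∀ m : ℕ, Function.Periodic (fun t =>
      ((c 0 * f.lineDeriv v y (m + 1) t 0 + c 1 * f.lineDeriv v y (m + 1) t 1 : ℝ) : ℂ)) 1 :=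
    fun m t => by simp only [f.periodic_lineDeriv hv y m t]
  have hb : ∀ m : ℕ, (∀ x, ‖iteratedFDeriv ℝ (m + 1) f.lift x‖ ≤ K) → ∀ t,
      ‖((c 0 * f.lineDeriv v y (m + 1) t 0 + c 1 * f.lineDeriv v y (m + 1) t 1 : ℝ) : ℂ)‖ ≤
        2 * b * K := fun m hm t => by
    have h := f.norm_lineDeriv_le (y := y) hv1 hm t
    have hi : ∀ i, |c i * f.lineDeriv v y (m + 1) t i| ≤ b * K := fun i => by
      rw [abs_mul]
      exact mul_le_mul (hc i) ((PiLp.norm_apply_le _ i).trans h) (abs_nonneg _)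
        ((abs_nonneg _).trans (hc i))
    rw [Complex.norm_real]
    refine (norm_add_le _ _).trans ?_
    linarith [hi 0, hi 1, Real.norm_eq_abs (c 0 * f.lineDeriv v y (m + 1) t 0),
      Real.norm_eq_abs (c 1 * f.lineDeriv v y (m + 1) t 1)]
  induction n generalizing m with
  | zero =>
    exact ⟨continuous_iff_continuousAt.2 fun t => (hd (m + 1) t).continuousAt, hp m,
      hb m (hK _ le_rfl le_rfl)⟩
  | succ n ih =>
    exact ⟨hp m, hb m (hK _ le_rfl (by omega)), _, hd (m + 1),
      ih (m + 1) fun j h1 h2 => hK j (by omega) (by omega)⟩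

/-- The integer vector `Aᵀ k`. -/
def dualMap (A : Matrix (Fin 2) (Fin 2) ℤ) (k : Fin 2 → ℤ) : Fin 2 → ℤ := Aᵀ *ᵥ k

theorem dualMap_apply (A : Matrix (Fin 2) (Fin 2) ℤ) (k : Fin 2 → ℤ) (i : Fin 2) :
    dualMap A k i = A 0 i * k 0 + A 1 i * k 1 := by
  simp [dualMap, Matrix.mulVec, dotProduct, Fin.sum_univ_two]

theorem lineDeriv_catMap (A : Matrix (Fin 2) (Fin 2) ℤ) (i : Fin 2) (y : Plane) (t : ℝ)
    (j : Fin 2) :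
    (catMap A).lineDeriv (EuclideanSpace.single i 1) y 1 t j = A j i := by
  rw [TorusMap.lineDeriv, iteratedFDeriv_one_apply]
  have : (catMap A).lift = ⇑(Matrix.toEuclideanCLM (n := Fin 2) (𝕜 := ℝ)
      (A.map (Int.cast : ℤ → ℝ))) := rfl
  rw [this, ContinuousLinearMap.fderiv]
  fin_cases i <;> simp [Matrix.mulVec, dotProduct]

theorem abs_intCast_apply_le (k : Fin 2 → ℤ) (i : Fin 2) : |(k i : ℝ)| ≤ ‖k‖ := by
  rw [← Int.norm_eq_abs]
  exact norm_le_pi_norm k i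

/-- Non-stationary phase with large parameter `‖w‖`, `w = l - Aᵀ k`. The condition `8 ε ‖k‖ ≤ ‖w‖`
keeps the phase derivative comparable to `‖w‖`, and `‖k‖ ≤ B ‖w‖` bounds its normalised higher
derivatives. The phase derivative already contains `Df`, so `N` integrations by parts use `N + 1`
derivatives of `f`. -/
theorem exists_norm_fourierMatrix_le (N : ℕ) (K B : ℝ) : ∃ C : ℝ, 0 ≤ C ∧
    ∀ (A : Matrix (Fin 2) (Fin 2) ℤ) (f : TorusMap) (ε : ℝ) (k l : Fin 2 → ℤ),
      (∀ x, ‖iteratedFDeriv ℝ 1 f.lift x - iteratedFDeriv ℝ 1 (catMap A).lift x‖ ≤ ε) →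
      (∀ j, 1 ≤ j → j ≤ N + 1 → ∀ x, ‖iteratedFDeriv ℝ j f.lift x‖ ≤ K) →
      l ≠ dualMap A k → 8 * ε * ‖k‖ ≤ ‖l - dualMap A k‖ → ‖k‖ ≤ B * ‖l - dualMap A k‖ →
      ‖fourierMatrix f k l‖ ≤ C * ‖l - dualMap A k‖⁻¹ ^ N := by
  obtain ⟨C, hC, hI⟩ := exists_norm_oscillatory_integral_le N
    (2 ^ N * (‖(2 * Real.pi * Complex.I : ℂ)‖ * ((2 + 2 * B * K) + 2 * B * K))) 1
  refine ⟨C, hC, fun A f ε k l h1 hK hne hε hB => ?_⟩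
  set w := l - dualMap A k with hw
  have hw0 : 0 < ‖w‖ := norm_pos_iff.2 (sub_ne_zero.2 hne)
  -- The line of integration follows the coordinate in which `w` attains its sup norm.
  obtain ⟨i, hi⟩ : ∃ i, ‖w‖ = |(w i : ℝ)| := by
    by_contra! h
    refine lt_irrefl _ ((pi_norm_lt_iff hw0).2 fun i => lt_of_le_of_ne (norm_le_pi_norm w i) ?_)
    rw [Int.norm_eq_abs]
    exact (h i).symm
  set v : Plane := EuclideanSpace.single i 1 with hv
  have hv1 : ‖v‖ = 1 := by simp [hv]
  have hv0 : proj v = 0 := by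
    funext j
    rw [proj, Pi.zero_apply, AddCircle.coe_eq_zero_iff]
    rcases eq_or_ne j i with rfl | h
    · exact ⟨1, by simp [hv]⟩
    · exact ⟨0, by simp [hv, h]⟩
  have hGc : Continuous fun y => mFourier l y * conj (expComp f k y) := by fun_prop
  rw [fourierMatrix, integral_torus_eq_integral_line hGc v]
  suffices h : ∀ y : Torus, ‖∫ t in (0 : ℝ)..1, mFourier l (proj (t • v) + y) *
      conj (expComp f k (proj (t • v) + y))‖ ≤ C * ‖w‖⁻¹ ^ N by
    have := norm_integral_le_of_norm_le_const (μ := torusVol) (Filter.Eventually.of_forall h)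
    simpa using this
  intro y
  obtain ⟨x, rfl⟩ := proj_surjective y
  set e : ℝ → ℂ := fun t => mFourier l (proj (x + t • v)) * conj (expComp f k (proj (x + t • v)))
    with he
  set g : ℝ → ℝ := fun t => k 0 * f.lineDeriv v x 1 t 0 + k 1 * f.lineDeriv v x 1 t 1 with hg
  have he' : ∀ t, e t = Complex.exp (2 * Real.pi * Complex.I *
      ((l 0 * (x + t • v) 0 + l 1 * (x + t • v) 1 -
        (k 0 * f.lineDeriv v x 0 t 0 + k 1 * f.lineDeriv v x 0 t 1) : ℝ) : ℂ)) := fun t => by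
    have h0 : f.lineDeriv v x 0 t = f.lift (x + t • v) := by
      rw [TorusMap.lineDeriv, iteratedFDeriv_zero_apply]
    simp only [he]
    rw [expComp_apply, f.proj_lift, ← mFourier_neg, mFourier_proj, mFourier_proj,
      ← Complex.exp_add, h0]
    congr 1
    simp only [Pi.neg_apply]
    push_cast
    ring
  have hed : ∀ t, HasDerivAt e (2 * Real.pi * Complex.I * ((l i - g t : ℝ) : ℂ) * e t) t :=
    fun t => by
    have hd := f.hasDerivAt_lineDeriv v x 0 t
    have hdi : ∀ j, HasDerivAt (fun t => f.lineDeriv v x 0 t j) (f.lineDeriv v x 1 t j) t :=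
      fun j => (EuclideanSpace.proj (𝕜 := ℝ) j).hasFDerivAt.comp_hasDerivAt t hd
    have hx : ∀ j, HasDerivAt (fun t : ℝ => (x + t • v) j) (v j) t := fun j => by
      simpa using ((hasDerivAt_id t).mul_const (v j)).const_add (x j)
    have hl : (l 0 : ℝ) * v 0 + l 1 * v 1 = l i := by
      fin_cases i <;> simp [hv]
    have hψ : HasDerivAt (fun t => l 0 * (x + t • v) 0 + l 1 * (x + t • v) 1 -
        (k 0 * f.lineDeriv v x 0 t 0 + k 1 * f.lineDeriv v x 0 t 1)) (l i - g t) t := by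
      rw [← hl]
      exact (((hx 0).const_mul (l 0 : ℝ)).add ((hx 1).const_mul (l 1 : ℝ))).sub
        (((hdi 0).const_mul (k 0 : ℝ)).add ((hdi 1).const_mul (k 1 : ℝ)))
    have := ((hψ.ofReal_comp).const_mul (2 * Real.pi * Complex.I)).cexp
    rw [funext he']
    convert this using 1
    ring
  -- Each of the two coordinates of `(Df - A)ᵀ k` contributes at most `ε ‖k‖ ≤ ‖w‖ / 8`, so the
  -- phase derivative over `2π` stays within `‖w‖ / 4` of `w i`.
  have hgA : ∀ t, |(l i - g t) - w i| ≤ ‖w‖ / 4 := fun t => by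
    have hj : ∀ j, |(k j : ℝ) * (f.lineDeriv v x 1 t j - A j i)| ≤ ‖k‖ * ε := fun j => by
      rw [abs_mul]
      refine mul_le_mul (abs_intCast_apply_le k j) ?_ (abs_nonneg _) (norm_nonneg _)
      rw [← lineDeriv_catMap A i x t j]
      have := (iteratedFDeriv ℝ 1 f.lift (x + t • v) -
        iteratedFDeriv ℝ 1 (catMap A).lift (x + t • v)).le_opNorm fun _ => v
      simp only [hv1, Finset.prod_const_one, mul_one] at this
      exact (PiLp.norm_apply_le _ j).trans (this.trans (h1 _))
    have : (l i - g t) - w i = -((k 0 : ℝ) * (f.lineDeriv v x 1 t 0 - A 0 i)) -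
        (k 1 : ℝ) * (f.lineDeriv v x 1 t 1 - A 1 i) := by
      simp only [hg, hw, Pi.sub_apply, dualMap_apply]
      push_cast
      ring
    rw [this]
    refine (abs_sub _ _).trans ?_
    rw [abs_neg]
    linarith [hj 0, hj 1]
  have hcb : ∀ j, |(k j : ℝ) / ‖w‖| ≤ B := fun j => by
    rw [abs_div, abs_of_pos hw0, div_le_iff₀ hw0]
    exact (abs_intCast_apply_le k j).trans hB
  have hdb := derivBound_lineDeriv f hv0 hv1 x (c := fun j => (k j : ℝ) / ‖w‖) hcb N 0
    (fun j hj1 hj2 => hK j (by omega) (by omega))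
  have hgw : ∀ t, ((k 0 : ℝ) / ‖w‖) * f.lineDeriv v x (0 + 1) t 0 +
      ((k 1 : ℝ) / ‖w‖) * f.lineDeriv v x (0 + 1) t 1 = g t / ‖w‖ := fun t => by
    simp only [hg, zero_add]
    ring
  simp only [hgw] at hdb
  have hlw : ‖(((l i : ℝ) / ‖w‖ : ℝ) : ℂ)‖ ≤ 2 + 2 * B * K := by
    have h2 := hdb.norm_le 0
    rw [Complex.norm_real, Real.norm_eq_abs] at h2 ⊢
    have h3 : |(l i - g 0) / ‖w‖| ≤ 2 := by
      rw [abs_div, abs_of_pos hw0, div_le_iff₀ hw0]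
      have := abs_le.1 (hgA 0)
      have h4 := abs_le.1 hi.ge
      rw [abs_le]
      constructor <;> linarith [this.1, this.2, h4.1, h4.2]
    have : (l i : ℝ) / ‖w‖ = (l i - g 0) / ‖w‖ + g 0 / ‖w‖ := by ring
    rw [this]
    exact (abs_add_le _ _).trans (add_le_add h3 h2)
  have hq := (DerivBound.const N (2 * Real.pi * Complex.I : ℂ)).mul
    (((DerivBound.const N (((l i : ℝ) / ‖w‖ : ℝ) : ℂ)).mono hlw).add hdb.neg)
  -- The normalised phase derivative `2πi (l i - g) / ‖w‖` plays the part of `q`, with amplitude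
  -- `1`.
  have key := hI ‖w‖ _ e (fun _ => 1) hw0 hq (fun t => ?_) (fun t => ?_) (fun t => ?_)
    (fun t => ?_) (by simpa using DerivBound.const N 1)
  · simpa [he, proj_add, add_comm] using key
  · have h5 : ((((l i : ℝ) / ‖w‖ : ℝ) : ℂ) + -((g t / ‖w‖ : ℝ) : ℂ)) =
        (((l i - g t) / ‖w‖ : ℝ) : ℂ) := by
      push_cast
      ring
    rw [h5, norm_mul, Complex.norm_real, Real.norm_eq_abs, abs_div, abs_of_pos hw0]
    have h6 : (3 : ℝ) / 4 ≤ |l i - g t| / ‖w‖ := by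
      rw [le_div_iff₀ hw0]
      have h7 := abs_sub_abs_le_abs_sub (w i : ℝ) (l i - g t)
      rw [abs_sub_comm (w i : ℝ)] at h7
      linarith [hgA t]
    have h8 : (2 : ℝ) ≤ ‖(2 * Real.pi * Complex.I : ℂ)‖ := by
      simp only [norm_mul, Complex.norm_ofNat, Complex.norm_real, Complex.norm_I, mul_one,
        Real.norm_of_nonneg Real.pi_pos.le]
      linarith [Real.pi_gt_three]
    nlinarith
  · convert hed t using 1
    have : (‖w‖ : ℂ) ≠ 0 := by exact_mod_cast hw0.ne'
    push_cast
    field_simp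
    ring
  · simp only [he, add_smul, one_smul, proj_add, hv0, add_zero]
  · simp only [he, norm_mul, RCLike.norm_conj]
    exact mul_le_one₀ (norm_mFourier_apply_le _ _) (norm_nonneg _) (norm_mFourier_apply_le _ _)

end PulsedDiffusion
end

noncomputable section
namespace PulsedDiffusion
open ENNReal

/-! ### Weighted square sums and the layer-cake estimate -/

/-- The weighted square sum `∑ W_k |c_k|²`. -/
def energy {ι : Type*} (W : ι → ℝ) (c : ι → ℂ) : ℝ≥0∞ :=
  ∑' k, ENNReal.ofReal (W k) * ‖c k‖ₑ ^ 2

theorem enorm_sq_eq_ofReal (z : ℂ) : ‖z‖ₑ ^ 2 = ENNReal.ofReal (‖z‖ ^ 2) := by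
  rw [ENNReal.ofReal_pow (norm_nonneg _), ofReal_norm]

theorem ofReal_mul_enorm_sq {w : ℝ} (hw : 0 ≤ w) (z : ℂ) :
    ENNReal.ofReal w * ‖z‖ₑ ^ 2 = ENNReal.ofReal (w * ‖z‖ ^ 2) := by
  rw [enorm_sq_eq_ofReal, ENNReal.ofReal_mul hw]

theorem energy_eq_ofReal {ι : Type*} {W : ι → ℝ} (hW : ∀ k, 0 ≤ W k) {c : ι → ℂ}
    (hs : Summable fun k => W k * ‖c k‖ ^ 2) :
    energy W c = ENNReal.ofReal (∑' k, W k * ‖c k‖ ^ 2) := by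
  rw [ENNReal.ofReal_tsum_of_nonneg (fun k => mul_nonneg (hW k) (sq_nonneg _)) hs]
  exact tsum_congr fun k => ofReal_mul_enorm_sq (hW k) _

theorem summable_of_energy_ne_top {ι : Type*} {W : ι → ℝ} (hW : ∀ k, 0 ≤ W k) {c : ι → ℂ}
    (h : energy W c ≠ ⊤) : Summable fun k => W k * ‖c k‖ ^ 2 := by
  refine (ENNReal.summable_toReal h).congr fun k => ?_
  rw [ofReal_mul_enorm_sq (hW k), ENNReal.toReal_ofReal (mul_nonneg (hW k) (sq_nonneg _))]

theorem energy_mono {ι : Type*} {W V : ι → ℝ} {c : ι → ℂ} (h : ∀ k, c k ≠ 0 → W k ≤ V k) :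
    energy W c ≤ energy V c := by
  refine ENNReal.tsum_le_tsum fun k => ?_
  by_cases hk : c k = 0
  · simp [hk]
  · gcongr
    exact h k hk

theorem energy_const_mul {ι : Type*} {W : ι → ℝ} {a : ℝ} (ha : 0 ≤ a) (c : ι → ℂ) :
    energy (fun k => a * W k) c = ENNReal.ofReal a * energy W c := by
  rw [energy, energy, ← ENNReal.tsum_mul_left]
  exact tsum_congr fun k => by rw [ENNReal.ofReal_mul ha, mul_assoc]

theorem energy_add {ι : Type*} {W V : ι → ℝ} (hW : ∀ k, 0 ≤ W k) (hV : ∀ k, 0 ≤ V k)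
    (c : ι → ℂ) : energy (fun k => W k + V k) c = energy W c + energy V c := by
  rw [energy, energy, energy, ← ENNReal.tsum_add]
  exact tsum_congr fun k => by rw [ENNReal.ofReal_add (hW k) (hV k), add_mul]

theorem energy_le_of_norm_le {ι : Type*} (W : ι → ℝ) {c d : ι → ℂ} (h : ∀ k, ‖c k‖ ≤ ‖d k‖) :
    energy W c ≤ energy W d := by
  refine ENNReal.tsum_le_tsum fun k => ?_
  gcongr
  exact enorm_le_iff_norm_le.2 (h k)

/-- Young's inequality with the first constant arbitrarily close to `1`, so that the contraction
rate is barely spoiled. -/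
theorem add_sq_le_ofReal {η : ℝ} (hη : 0 < η) (x y : ℝ≥0∞) :
    (x + y) ^ 2 ≤ ENNReal.ofReal (1 + η) * x ^ 2 + ENNReal.ofReal (1 + η⁻¹) * y ^ 2 := by
  have h1 : ENNReal.ofReal (1 + η) ≠ 0 := by simpa using by linarith
  have h2 : ENNReal.ofReal (1 + η⁻¹) ≠ 0 := by
    have := inv_pos.2 hη
    simpa using by linarith
  by_cases hx : x = ⊤
  · rw [hx, ENNReal.top_pow two_ne_zero, ENNReal.mul_top h1]
    simp
  by_cases hy : y = ⊤
  · rw [hy, ENNReal.top_pow two_ne_zero, ENNReal.mul_top h2]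
    simp
  obtain ⟨a, rfl⟩ : ∃ a : NNReal, (a : ℝ≥0∞) = x := ⟨x.toNNReal, ENNReal.coe_toNNReal hx⟩
  obtain ⟨b, rfl⟩ : ∃ b : NNReal, (b : ℝ≥0∞) = y := ⟨y.toNNReal, ENNReal.coe_toNNReal hy⟩
  rw [← ENNReal.ofReal_coe_nnreal (p := a), ← ENNReal.ofReal_coe_nnreal (p := b),
    ← ENNReal.ofReal_add a.coe_nonneg b.coe_nonneg, ← ENNReal.ofReal_pow (by positivity),
    ← ENNReal.ofReal_pow a.coe_nonneg, ← ENNReal.ofReal_pow b.coe_nonneg, ← ENNReal.ofReal_mul (by positivity),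
    ← ENNReal.ofReal_mul (by positivity), ← ENNReal.ofReal_add (by positivity) (by positivity)]
  refine ENNReal.ofReal_le_ofReal ?_
  have h : 0 ≤ (η * a - b) ^ 2 * η⁻¹ := by positivity
  have h' : (η * a - b) ^ 2 * η⁻¹ = η * (a : ℝ) ^ 2 - 2 * a * b + η⁻¹ * (b : ℝ) ^ 2 := by
    field_simp
    ring
  nlinarith

theorem tsum_mul_sq_le {ι : Type*} (f g : ι → ℝ≥0∞) :
    (∑' i, f i * g i) ^ 2 ≤ (∑' i, f i ^ 2) * ∑' i, g i ^ 2 := by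
  have h : ∑' i, f i * g i ≤ (∑' i, f i ^ 2) ^ (1 / 2 : ℝ) * (∑' i, g i ^ 2) ^ (1 / 2 : ℝ) := by
    rw [ENNReal.tsum_eq_iSup_sum]
    refine iSup_le fun s => ?_
    refine (ENNReal.inner_le_Lp_mul_Lq s f g Real.HolderConjugate.two_two).trans ?_
    simp only [ENNReal.rpow_ofNat]
    gcongr <;> exact ENNReal.sum_le_tsum s
  have hsq : ∀ x : ℝ≥0∞, (x ^ (1 / 2 : ℝ)) ^ 2 = x := fun x => by
    rw [← ENNReal.rpow_natCast, ← ENNReal.rpow_mul]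
    norm_num
  calc _ ≤ _ := pow_le_pow_left' h 2
    _ = _ := by rw [mul_pow, hsq, hsq]

theorem lintegral_indicator_Ioo (w : ℝ) (x : ℝ≥0∞) :
    ∫⁻ t : ℝ, (Set.Ioo 0 w).indicator (fun _ => x) t = ENNReal.ofReal w * x := by
  rw [lintegral_indicator_const measurableSet_Ioo, Real.volume_Ioo, sub_zero, mul_comm]

open Classical in
/-- If a matrix contracts `ℓ²` and the weights are related on the entries marked by `near`, then
it is bounded between the weighted spaces up to the contribution of the other entries. -/
theorem energy_le_layercake {ι : Type*} [Countable ι] {M : ι → ι → ℂ}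
    (hM : ∀ d : ι → ℂ, ∑' k, ‖∑' l, M k l * d l‖ₑ ^ 2 ≤ ∑' l, ‖d l‖ₑ ^ 2)
    {near : ι → ι → Prop} {W V : ι → ℝ} (hWV : ∀ k l, near k l → W k ≤ V l) {c : ι → ℂ}
    (hc : ∀ k, Summable fun l => M k l * c l) {η : ℝ} (hη : 0 < η) :
    energy W (fun k => ∑' l, M k l * c l) ≤ ENNReal.ofReal (1 + η) * energy V c +
      ENNReal.ofReal (1 + η⁻¹) * ∑' k, ENNReal.ofReal (W k) *
        (∑' l, if near k l then 0 else ‖M k l‖ₑ * ‖c l‖ₑ) ^ 2 := by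
  set F : ι → ℝ≥0∞ := fun k => ∑' l, if near k l then 0 else ‖M k l‖ₑ * ‖c l‖ₑ with hF
  have hmeas : ∀ (w : ℝ) (x : ℝ≥0∞),
      Measurable fun t : ℝ => (Set.Ioo 0 w).indicator (fun _ => x) t :=
    fun w x => measurable_const.indicator measurableSet_Ioo
  have hlc : ∀ (U : ι → ℝ) (x : ι → ℝ≥0∞), ∑' k, ENNReal.ofReal (U k) * x k =
      ∫⁻ t : ℝ, ∑' k, (Set.Ioo 0 (U k)).indicator (fun _ => x k) t := fun U x => by
    rw [lintegral_tsum fun k => (hmeas _ _).aemeasurable]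
    exact tsum_congr fun k => (lintegral_indicator_Ioo _ _).symm
  have hmt : ∀ (U : ι → ℝ) (x : ι → ℝ≥0∞),
      Measurable fun t : ℝ => ∑' k, (Set.Ioo 0 (U k)).indicator (fun _ => x k) t :=
    fun U x => Measurable.tsum fun k => hmeas _ _
  rw [energy, energy, hlc, hlc, hlc, ← lintegral_const_mul _ (hmt _ _),
    ← lintegral_const_mul _ (hmt _ _), ← lintegral_add_left ((hmt _ _).const_mul _)]
  refine lintegral_mono fun t => ?_
  -- At level `t`, `d` is `c` cut off to the superlevel set of `V`, so that `M` can be applied to it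
  -- as an `ℓ²` contraction.
  set d : ι → ℂ := fun l => if t ∈ Set.Ioo 0 (V l) then c l else 0 with hd
  have hd1 : ∀ l, t ∈ Set.Ioo 0 (V l) → d l = c l := fun l h => if_pos h
  have hd0 : ∀ l, t ∉ Set.Ioo 0 (V l) → d l = 0 := fun l h => if_neg h
  have hdR : ∑' l, (Set.Ioo 0 (V l)).indicator (fun _ => ‖c l‖ₑ ^ 2) t = ∑' l, ‖d l‖ₑ ^ 2 := by
    refine tsum_congr fun l => ?_
    by_cases h : t ∈ Set.Ioo 0 (V l)
    · rw [Set.indicator_of_mem h, hd1 l h]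
    · rw [Set.indicator_of_notMem h, hd0 l h]
      simp
  rw [hdR]
  calc ∑' k, (Set.Ioo 0 (W k)).indicator (fun _ => ‖∑' l, M k l * c l‖ₑ ^ 2) t
      ≤ ∑' k, (ENNReal.ofReal (1 + η) * ‖∑' l, M k l * d l‖ₑ ^ 2 +
          ENNReal.ofReal (1 + η⁻¹) * (Set.Ioo 0 (W k)).indicator (fun _ => F k ^ 2) t) := by
        refine ENNReal.tsum_le_tsum fun k => ?_
        by_cases hk : t ∈ Set.Ioo 0 (W k)
        swap
        · simp [hk]
        simp only [Set.indicator_of_mem hk]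
        have hs1 : Summable fun l => M k l * d l := by
          refine Summable.of_norm_bounded (hc k).norm fun l => ?_
          by_cases h : t ∈ Set.Ioo 0 (V l)
          · rw [hd1 l h]
          · rw [hd0 l h, mul_zero, norm_zero]
            exact norm_nonneg _
        have hs2 : Summable fun l => M k l * (c l - d l) := by
          simpa only [mul_sub] using (hc k).sub hs1
        have hsplit : ∑' l, M k l * c l = (∑' l, M k l * d l) + ∑' l, M k l * (c l - d l) := by
          rw [← hs1.tsum_add hs2]
          exact tsum_congr fun l => by ring
        have hfar : ‖∑' l, M k l * (c l - d l)‖ₑ ≤ F k := by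
          refine enorm_tsum_le_tsum_enorm.trans (ENNReal.tsum_le_tsum fun l => ?_)
          by_cases h : t ∈ Set.Ioo 0 (V l)
          · simp [hd1 l h]
          -- An entry cut off by `d` has `V l ≤ t < W k`, so it cannot be near: the error consists
          -- of far entries alone.
          · have hn : ¬ near k l := fun hn => h ⟨hk.1, hk.2.trans_le (hWV k l hn)⟩
            simp [hd0 l h, hn, enorm_mul]
        calc ‖∑' l, M k l * c l‖ₑ ^ 2
            ≤ (‖∑' l, M k l * d l‖ₑ + F k) ^ 2 := by
              rw [hsplit]
              exact pow_le_pow_left' ((enorm_add_le _ _).trans (by gcongr)) 2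
          _ ≤ _ := add_sq_le_ofReal hη _ _
    _ ≤ _ := by
        rw [ENNReal.tsum_add, ENNReal.tsum_mul_left, ENNReal.tsum_mul_left]
        exact add_le_add (mul_le_mul_right (hM d) _) le_rfl

/-- The bracket `1 + |k|`. -/
def bracket (k : Fin 2 → ℤ) : ℝ := 1 + ‖k‖

theorem one_le_bracket (k : Fin 2 → ℤ) : 1 ≤ bracket k := by
  have := norm_nonneg k
  unfold bracket
  linarith

theorem bracket_pos (k : Fin 2 → ℤ) : 0 < bracket k := one_pos.trans_le (one_le_bracket k)

theorem summable_bracket_rpow {a : ℝ} (ha : a < -2) : Summable fun k => bracket k ^ a := by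
  have h := EisensteinSeries.summable_one_div_norm_rpow (k := -a) (by linarith)
  rw [neg_neg] at h
  refine Summable.of_norm_bounded_eventually h ?_
  filter_upwards [(Set.finite_singleton (0 : Fin 2 → ℤ)).compl_mem_cofinite] with k hk
  rw [Real.norm_of_nonneg (Real.rpow_nonneg (bracket_pos k).le _)]
  refine Real.rpow_le_rpow_of_nonpos (norm_pos_iff.2 hk) ?_ (by linarith)
  unfold bracket
  linarith

/-- The weight of the weak norm. -/
def weakWeight (s : ℝ) (k : Fin 2 → ℤ) : ℝ := bracket k ^ (-(2 * s))

theorem weakWeight_nonneg (s : ℝ) (k : Fin 2 → ℤ) : 0 ≤ weakWeight s k :=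
  Real.rpow_nonneg (bracket_pos k).le _

-- The decay exponent is `s + 2` because Cauchy–Schwarz in `l` against the weak norm, and the sum
-- over `k` against a weight of order `2s`, both leave `∑ bracket ^ (-4)`, which converges on a
-- rank-two lattice.
open Classical in
theorem exists_tsum_far_le {s : ℝ} (B D : ℝ) : ∃ C : ℝ, 0 ≤ C ∧
    ∀ (M : (Fin 2 → ℤ) → (Fin 2 → ℤ) → ℂ) (near : (Fin 2 → ℤ) → (Fin 2 → ℤ) → Prop)
      (W : (Fin 2 → ℤ) → ℝ) (c : (Fin 2 → ℤ) → ℂ),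
      (∀ k, W k ≤ B * bracket k ^ (2 * s)) →
      (∀ k l, ¬ near k l → ‖M k l‖ ≤ D * (bracket k ^ (-(s + 2)) * bracket l ^ (-(s + 2)))) →
      ∑' k, ENNReal.ofReal (W k) * (∑' l, if near k l then 0 else ‖M k l‖ₑ * ‖c l‖ₑ) ^ 2 ≤
        ENNReal.ofReal C * energy (weakWeight s) c := by
  have hs4 : Summable fun k => bracket k ^ (-4 : ℝ) := summable_bracket_rpow (by norm_num)
  set Z : ℝ := ∑' k, bracket k ^ (-4 : ℝ) with hZ
  have hZ0 : 0 ≤ Z := tsum_nonneg fun k => Real.rpow_nonneg (bracket_pos k).le _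
  have hZe : ∑' k, ENNReal.ofReal (bracket k ^ (-4 : ℝ)) = ENNReal.ofReal Z :=
    (ENNReal.ofReal_tsum_of_nonneg (fun k => Real.rpow_nonneg (bracket_pos k).le _) hs4).symm
  refine ⟨|B| * |D| ^ 2 * Z * Z, by positivity, fun M near W c hW hM => ?_⟩
  set S := energy (weakWeight s) c with hS
  have h1 : (∑' l, ENNReal.ofReal (bracket l ^ (-(s + 2))) * ‖c l‖ₑ) ^ 2 ≤
      ENNReal.ofReal Z * S := by
    have hcs := tsum_mul_sq_le (fun l => ENNReal.ofReal (bracket l ^ (-2 : ℝ)))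
      (fun l => ENNReal.ofReal (bracket l ^ (-s)) * ‖c l‖ₑ)
    have ha : ∀ l, ENNReal.ofReal (bracket l ^ (-2 : ℝ)) *
        (ENNReal.ofReal (bracket l ^ (-s)) * ‖c l‖ₑ) =
        ENNReal.ofReal (bracket l ^ (-(s + 2))) * ‖c l‖ₑ := fun l => by
      rw [← mul_assoc, ← ENNReal.ofReal_mul (Real.rpow_nonneg (bracket_pos l).le _),
        ← Real.rpow_add (bracket_pos l)]
      ring_nf
    have hb : ∀ l, ENNReal.ofReal (bracket l ^ (-2 : ℝ)) ^ 2 =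
        ENNReal.ofReal (bracket l ^ (-4 : ℝ)) := fun l => by
      rw [← ENNReal.ofReal_pow (Real.rpow_nonneg (bracket_pos l).le _),
        ← Real.rpow_mul_natCast (bracket_pos l).le]
      norm_num
    have hd : ∀ l, (ENNReal.ofReal (bracket l ^ (-s)) * ‖c l‖ₑ) ^ 2 =
        ENNReal.ofReal (weakWeight s l) * ‖c l‖ₑ ^ 2 := fun l => by
      rw [mul_pow, ← ENNReal.ofReal_pow (Real.rpow_nonneg (bracket_pos l).le _),
        ← Real.rpow_mul_natCast (bracket_pos l).le, weakWeight]
      congr 3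
      push_cast
      ring
    simp only [ha, hb, hd, hZe] at hcs
    exact hcs
  have h2 : ∀ k, (∑' l, if near k l then 0 else ‖M k l‖ₑ * ‖c l‖ₑ) ≤
      ENNReal.ofReal (|D| * bracket k ^ (-(s + 2))) *
        ∑' l, ENNReal.ofReal (bracket l ^ (-(s + 2))) * ‖c l‖ₑ := fun k => by
    rw [← ENNReal.tsum_mul_left]
    refine ENNReal.tsum_le_tsum fun l => ?_
    split_ifs with h
    · exact zero_le
    · rw [← mul_assoc, ← ENNReal.ofReal_mul
        (mul_nonneg (abs_nonneg _) (Real.rpow_nonneg (bracket_pos k).le _))]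
      gcongr
      rw [← ofReal_norm]
      refine ENNReal.ofReal_le_ofReal ((hM k l h).trans ?_)
      rw [mul_assoc]
      exact mul_le_mul_of_nonneg_right (le_abs_self D) (mul_nonneg
        (Real.rpow_nonneg (bracket_pos k).le _) (Real.rpow_nonneg (bracket_pos l).le _))
  calc _ ≤ ∑' k, ENNReal.ofReal (|B| * |D| ^ 2 * bracket k ^ (-4 : ℝ)) *
        (ENNReal.ofReal Z * S) := by
        refine ENNReal.tsum_le_tsum fun k => ?_
        calc _ ≤ ENNReal.ofReal (|B| * bracket k ^ (2 * s)) *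
              ((ENNReal.ofReal (|D| * bracket k ^ (-(s + 2)))) ^ 2 * (ENNReal.ofReal Z * S)) := by
              refine mul_le_mul' (ENNReal.ofReal_le_ofReal ((hW k).trans ?_)) ?_
              · exact mul_le_mul_of_nonneg_right (le_abs_self B)
                  (Real.rpow_nonneg (bracket_pos k).le _)
              · refine (pow_le_pow_left' (h2 k) 2).trans ?_
                rw [mul_pow]
                gcongr
          _ = _ := by
              rw [← mul_assoc, ← ENNReal.ofReal_pow (mul_nonneg (abs_nonneg _)
                (Real.rpow_nonneg (bracket_pos k).le _)), ← ENNReal.ofReal_mul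
                (mul_nonneg (abs_nonneg _) (Real.rpow_nonneg (bracket_pos k).le _))]
              congr 2
              rw [mul_pow, ← Real.rpow_mul_natCast (bracket_pos k).le]
              have : bracket k ^ (2 * s) * bracket k ^ (-(s + 2) * ((2 : ℕ) : ℝ)) =
                  bracket k ^ (-4 : ℝ) := by
                rw [← Real.rpow_add (bracket_pos k)]
                congr 1
                push_cast
                ring
              rw [← this]
              ring
    _ = _ := by
        rw [ENNReal.tsum_mul_right]
        simp only [ENNReal.ofReal_mul (show 0 ≤ |B| * |D| ^ 2 by positivity)]
        rw [ENNReal.tsum_mul_left, hZe,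
          ENNReal.ofReal_mul (show 0 ≤ |B| * |D| ^ 2 * Z by positivity),
          ENNReal.ofReal_mul (show 0 ≤ |B| * |D| ^ 2 by positivity)]
        ring

/-- All but finitely many `l` are far from the fixed `k`; there the decay and the
arithmetic-geometric inequality dominate the terms by two convergent series. -/
theorem summable_mul_of_energy_weak {s : ℝ} {D : ℝ} {M : (Fin 2 → ℤ) → (Fin 2 → ℤ) → ℂ}
    {near : (Fin 2 → ℤ) → (Fin 2 → ℤ) → Prop} {c : (Fin 2 → ℤ) → ℂ} (k : Fin 2 → ℤ)
    (hfin : {l | near k l}.Finite)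
    (hM : ∀ l, ¬ near k l → ‖M k l‖ ≤ D * (bracket k ^ (-(s + 2)) * bracket l ^ (-(s + 2))))
    (hc : energy (weakWeight s) c ≠ ⊤) : Summable fun l => M k l * c l := by
  have h1 := summable_of_energy_ne_top (weakWeight_nonneg s) hc
  have h2 : Summable fun l => bracket l ^ (-4 : ℝ) := summable_bracket_rpow (by norm_num)
  refine Summable.of_norm_bounded_eventually
    ((h2.add h1).mul_left (|D| * bracket k ^ (-(s + 2)))) ?_
  filter_upwards [hfin.compl_mem_cofinite] with l hl
  have hk := Real.rpow_nonneg (bracket_pos k).le (-(s + 2))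
  have hb := Real.rpow_nonneg (bracket_pos l).le (-(s + 2))
  have hM' : ‖M k l‖ ≤ |D| * (bracket k ^ (-(s + 2)) * bracket l ^ (-(s + 2))) :=
    (hM l hl).trans (mul_le_mul_of_nonneg_right (le_abs_self D) (mul_nonneg hk hb))
  have hamgm : bracket l ^ (-(s + 2)) * ‖c l‖ ≤
      bracket l ^ (-4 : ℝ) + weakWeight s l * ‖c l‖ ^ 2 := by
    have e1 : bracket l ^ (-(s + 2)) = bracket l ^ (-2 : ℝ) * bracket l ^ (-s) := by
      rw [← Real.rpow_add (bracket_pos l)]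
      ring_nf
    have e2 : bracket l ^ (-4 : ℝ) = (bracket l ^ (-2 : ℝ)) ^ 2 := by
      rw [← Real.rpow_mul_natCast (bracket_pos l).le]
      norm_num
    have e3 : weakWeight s l = (bracket l ^ (-s)) ^ 2 := by
      rw [← Real.rpow_mul_natCast (bracket_pos l).le, weakWeight]
      congr 1
      push_cast
      ring
    rw [e1, e2, e3]
    nlinarith [sq_nonneg (bracket l ^ (-2 : ℝ) - bracket l ^ (-s) * ‖c l‖),
      sq_nonneg (bracket l ^ (-2 : ℝ)), sq_nonneg (bracket l ^ (-s) * ‖c l‖)]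
  rw [norm_mul]
  calc ‖M k l‖ * ‖c l‖
      ≤ |D| * (bracket k ^ (-(s + 2)) * bracket l ^ (-(s + 2))) * ‖c l‖ := by gcongr
    _ = |D| * bracket k ^ (-(s + 2)) * (bracket l ^ (-(s + 2)) * ‖c l‖) := by ring
    _ ≤ _ := by gcongr

end PulsedDiffusion
end

noncomputable section
namespace PulsedDiffusion

/-! ### Eigencoordinates and the adapted weight -/

/-- Linear coordinates on wavenumbers that diagonalise `Aᵀ`, scaled so that the unstable cone is
`|stab| ≤ |unst|`. -/
structure EigenCoords (A : Matrix (Fin 2) (Fin 2) ℤ) (lam : ℝ) where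
  unst : (Fin 2 → ℝ) →ₗ[ℝ] ℝ
  stab : (Fin 2 → ℝ) →ₗ[ℝ] ℝ
  bd : ℝ
  one_le_bd : 1 ≤ bd
  abs_unst_mulVec : ∀ w, |unst ((A.map (Int.cast : ℤ → ℝ))ᵀ *ᵥ w)| = lam * |unst w|
  abs_stab_mulVec : ∀ w, |stab ((A.map (Int.cast : ℤ → ℝ))ᵀ *ᵥ w)| = lam⁻¹ * |stab w|
  mem_cone_iff : ∀ w, w ∈ unstableCone A ↔ |stab w| ≤ |unst w|
  abs_unst_le : ∀ w, |unst w| ≤ bd * ‖w‖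
  abs_stab_le : ∀ w, |stab w| ≤ bd * ‖w‖
  norm_le : ∀ w, ‖w‖ ≤ bd * max |unst w| |stab w|

theorem exists_unit_eigenvector {B : Matrix (Fin 2) (Fin 2) ℝ} {μ : ℝ}
    (h : μ ^ 2 - B.trace * μ + B.det = 0) : ∃ v : Fin 2 → ℝ, v ⬝ᵥ v = 1 ∧ B *ᵥ v = μ • v := by
  have hdet : (B - Matrix.diagonal fun _ => μ).det = 0 := by
    rw [Matrix.det_fin_two] at h ⊢
    rw [Matrix.trace_fin_two] at h
    simp
    linarith
  obtain ⟨v, hv0, hv⟩ := Matrix.exists_mulVec_eq_zero_iff.2 hdet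
  have hev : B *ᵥ v = μ • v := by
    rw [Matrix.sub_mulVec, sub_eq_zero] at hv
    rw [hv]
    ext i
    simp [Matrix.mulVec_diagonal]
  have hpos : 0 < v ⬝ᵥ v := by
    have h0 : 0 ≤ v ⬝ᵥ v := by
      simp only [dotProduct, Fin.sum_univ_two]
      nlinarith [sq_nonneg (v 0), sq_nonneg (v 1)]
    exact lt_of_le_of_ne h0 fun h => hv0 (dotProduct_self_eq_zero.1 h.symm)
  refine ⟨(Real.sqrt (v ⬝ᵥ v))⁻¹ • v, ?_, ?_⟩
  · rw [smul_dotProduct, dotProduct_smul, smul_eq_mul, smul_eq_mul, ← mul_assoc, ← mul_inv,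
      Real.mul_self_sqrt hpos.le, inv_mul_cancel₀ hpos.ne']
  · rw [Matrix.mulVec_smul, hev, smul_comm]

/-- The second eigenvalue is `ν = tr A - μ`, and `μ ν = ±1` gives it modulus `lam⁻¹`. The
coordinates are those of the basis of unit eigenvectors of `Aᵀ`, by Cramer's rule. -/
theorem nonempty_eigenCoords {A : Matrix (Fin 2) (Fin 2) ℤ} (hA : IsHyperbolic A) {lam : ℝ}
    (hlam : IsExpansionRate A lam) : Nonempty (EigenCoords A lam) := by
  obtain ⟨hl1, μ, hμ, hμl⟩ := hlam
  set B : Matrix (Fin 2) (Fin 2) ℝ := A.map (Int.cast : ℤ → ℝ) with hB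
  have hdet1 : |B.det| = 1 := by
    have : B.det = (A.det : ℝ) := by
      simp [hB, Matrix.det_fin_two]
    rw [this]
    rcases hA.1 with h | h <;> simp [h]
  have hchar : μ ^ 2 - B.trace * μ + B.det = 0 := by
    obtain ⟨x, hx⟩ := hμ.exists_hasEigenvector
    have hx1 : B *ᵥ x = μ • x := by
      have := hx.apply_eq_smul
      rwa [Matrix.toLin'_apply] at this
    have hz : (B - Matrix.diagonal fun _ => μ) *ᵥ x = 0 := by
      rw [Matrix.sub_mulVec, hx1, sub_eq_zero]
      ext i
      simp [Matrix.mulVec_diagonal]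
    have hdet := Matrix.exists_mulVec_eq_zero_iff.1 ⟨x, hx.2, hz⟩
    rw [Matrix.det_fin_two] at hdet ⊢
    rw [Matrix.trace_fin_two]
    simp at hdet
    linarith
  set ν : ℝ := B.trace - μ with hν
  have hprod : μ * ν = B.det := by
    rw [hν]
    linarith
  have hchar' : ν ^ 2 - B.trace * ν + B.det = 0 := by
    rw [← hprod, hν]
    ring
  have hνl : |ν| = lam⁻¹ := by
    have : |μ| * |ν| = 1 := by rw [← abs_mul, hprod, hdet1]
    rw [hμl] at this
    exact eq_inv_of_mul_eq_one_right this
  have hlinv : lam⁻¹ < 1 := inv_lt_one_of_one_lt₀ hl1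
  rw [← Matrix.trace_transpose, ← Matrix.det_transpose] at hchar hchar'
  obtain ⟨vu, hvu1, hvu⟩ := exists_unit_eigenvector hchar
  obtain ⟨vs, hvs1, hvs⟩ := exists_unit_eigenvector hchar'
  have hne : μ ≠ ν := fun h => by
    rw [← h, hμl] at hνl
    linarith
  set D : ℝ := vu 0 * vs 1 - vu 1 * vs 0 with hD
  -- If `D = 0` then `vs` is a multiple of `vu`, hence an eigenvector for both `μ` and `ν`, which
  -- forces it to vanish.
  have hD0 : D ≠ 0 := fun h => by
    have hu : ∀ i, (Bᵀ *ᵥ vu) i = μ * vu i := fun i => by rw [hvu]; simp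
    have hs : ∀ i, (Bᵀ *ᵥ vs) i = ν * vs i := fun i => by rw [hvs]; simp
    have hu0 := hu 0
    have hu1 := hu 1
    have hs0 := hs 0
    have hs1 := hs 1
    simp only [Matrix.mulVec, dotProduct, Fin.sum_univ_two] at hu0 hu1 hs0 hs1 hvu1 hvs1
    have e0 : ∀ i j, vu i * vs j = vu j * vs i := fun i j => by
      fin_cases i <;> fin_cases j <;> simp <;> linarith
    have key : ∀ j, (μ - ν) * (vs j * (vu 0 * vu 0 + vu 1 * vu 1)) = 0 := fun j => by
      have a0 := e0 0 j
      have a1 := e0 1 j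
      have c0 : vs j * (vu 0 * vu 0 + vu 1 * vu 1) = vu j * (vs 0 * vu 0 + vs 1 * vu 1) := by
        linear_combination vu 0 * a0 + vu 1 * a1
      have hpar : ∀ i, vs i = (vs 0 * vu 0 + vs 1 * vu 1) * vu i := fun i => by
        have b0 := e0 0 i
        have b1 := e0 1 i
        linear_combination vu 0 * b0 + vu 1 * b1 - vs i * hvu1
      set t := vs 0 * vu 0 + vs 1 * vu 1
      have p0 := hpar 0
      have p1 := hpar 1
      have q : ∀ i, ν * vs i = μ * vs i := fun i => by
        have : Bᵀ *ᵥ vs = t • (Bᵀ *ᵥ vu) := by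
          rw [← Matrix.mulVec_smul]
          congr 1
          ext i
          simpa using hpar i
        have := congrFun this i
        rw [hvs, hvu] at this
        simp only [Pi.smul_apply, smul_eq_mul] at this
        rw [this]
        linear_combination -μ * hpar i
      linear_combination -(vu 0 * vu 0 + vu 1 * vu 1) * q j
    have hz : ∀ j, vs j = 0 := fun j => by
      have := key j
      rw [hvu1, mul_one] at this
      exact (mul_eq_zero.1 this).resolve_left (sub_ne_zero.2 hne)
    rw [hz 0, hz 1] at hvs1
    norm_num at hvs1
  let un : (Fin 2 → ℝ) →ₗ[ℝ] ℝ :=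
    { toFun := fun w => (w 0 * vs 1 - w 1 * vs 0) / D
      map_add' := fun x y => by simp only [Pi.add_apply]; ring
      map_smul' := fun c x => by
        simp only [Pi.smul_apply, smul_eq_mul, RingHom.id_apply]; ring }
  let st : (Fin 2 → ℝ) →ₗ[ℝ] ℝ :=
    { toFun := fun w => (vu 0 * w 1 - vu 1 * w 0) / D
      map_add' := fun x y => by simp only [Pi.add_apply]; ring
      map_smul' := fun c x => by
        simp only [Pi.smul_apply, smul_eq_mul, RingHom.id_apply]; ring }
  have hun : ∀ w, un w = (w 0 * vs 1 - w 1 * vs 0) / D := fun _ => rfl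
  have hst : ∀ w, st w = (vu 0 * w 1 - vu 1 * w 0) / D := fun _ => rfl
  have hunu : un vu = 1 := by rw [hun]; exact div_self hD0
  have huns : un vs = 0 := by rw [hun]; ring
  have hstu : st vu = 0 := by rw [hst]; ring
  have hsts : st vs = 1 := by rw [hst]; exact div_self hD0
  have hdec : ∀ w, w = un w • vu + st w • vs := fun w => by
    ext i
    simp only [Pi.add_apply, Pi.smul_apply, smul_eq_mul, hun, hst]
    field_simp
    rw [hD]
    fin_cases i <;> simp <;> ring
  have hunA : ∀ w, un (Bᵀ *ᵥ w) = μ * un w := fun w => by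
    conv_lhs => rw [hdec w]
    rw [Matrix.mulVec_add, Matrix.mulVec_smul, Matrix.mulVec_smul, hvu, hvs]
    simp only [map_add, map_smul, hunu, huns, smul_eq_mul]
    ring
  have hstA : ∀ w, st (Bᵀ *ᵥ w) = ν * st w := fun w => by
    conv_lhs => rw [hdec w]
    rw [Matrix.mulVec_add, Matrix.mulVec_smul, Matrix.mulVec_smul, hvu, hvs]
    simp only [map_add, map_smul, hstu, hsts, smul_eq_mul]
    ring
  have hcone : ∀ w, w ∈ unstableCone A ↔ |st w| ≤ |un w| := fun w => by
    constructor
    -- Any admissible eigenvectors agree with `vu`, `vs` up to sign: a nonzero stable coordinate of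
    -- `vu'` would make its eigenvalue `ν`, and likewise for `vs'`.
    · rintro ⟨μ', ν', vu', vs', hμ', ⟨h1, h2⟩, hν', ⟨h3, h4⟩, a, b, rfl, hab⟩
      rw [← hB] at h2 h4
      have g1 : st vu' = 0 := by
        have := hstA vu'
        rw [h2, map_smul, smul_eq_mul] at this
        by_contra h0
        have h5 := mul_right_cancel₀ h0 this
        rw [h5, hνl] at hμ'
        linarith
      have g2 : un vs' = 0 := by
        have := hunA vs'
        rw [h4, map_smul, smul_eq_mul] at this
        by_contra h0
        have h5 := mul_right_cancel₀ h0 this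
        rw [h5, hμl] at hν'
        linarith
      have g3 : |un vu'| = 1 := by
        have h5 := hdec vu'
        rw [g1, zero_smul, add_zero] at h5
        rw [h5, smul_dotProduct, dotProduct_smul, hvu1, smul_eq_mul, smul_eq_mul, mul_one] at h1
        rw [← abs_mul_abs_self] at h1
        nlinarith [abs_nonneg (un vu')]
      have g4 : |st vs'| = 1 := by
        have h5 := hdec vs'
        rw [g2, zero_smul, zero_add] at h5
        rw [h5, smul_dotProduct, dotProduct_smul, hvs1, smul_eq_mul, smul_eq_mul, mul_one] at h3
        rw [← abs_mul_abs_self] at h3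
        nlinarith [abs_nonneg (st vs')]
      simpa [g1, g2, g3, g4, abs_mul] using hab
    · intro h
      exact ⟨μ, ν, vu, vs, by rw [hμl]; exact hl1, ⟨hvu1, hvu⟩, by rw [hνl]; exact hlinv,
        ⟨hvs1, hvs⟩, un w, st w, hdec w, h⟩
  set b : ℝ := max 1 (max (max ‖LinearMap.toContinuousLinearMap un‖
    ‖LinearMap.toContinuousLinearMap st‖) (‖vu‖ + ‖vs‖)) with hb
  have hbu : ‖LinearMap.toContinuousLinearMap un‖ ≤ b :=
    (le_max_left _ _).trans ((le_max_left _ _).trans (le_max_right _ _))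
  have hbs : ‖LinearMap.toContinuousLinearMap st‖ ≤ b :=
    (le_max_right _ _).trans ((le_max_left _ _).trans (le_max_right _ _))
  have hbv : ‖vu‖ + ‖vs‖ ≤ b := (le_max_right _ _).trans (le_max_right _ _)
  refine ⟨⟨un, st, b, le_max_left _ _, fun w => by rw [← hB, hunA, abs_mul, hμl],
    fun w => by rw [← hB, hstA, abs_mul, hνl], hcone, fun w => ?_, fun w => ?_, fun w => ?_⟩⟩
  · have := (LinearMap.toContinuousLinearMap un).le_of_opNorm_le hbu w
    simpa using this
  · have := (LinearMap.toContinuousLinearMap st).le_of_opNorm_le hbs w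
    simpa using this
  · have hm : 0 ≤ max |un w| |st w| := (abs_nonneg _).trans (le_max_left _ _)
    calc ‖w‖ = ‖un w • vu + st w • vs‖ := by rw [← hdec w]
      _ ≤ |un w| * ‖vu‖ + |st w| * ‖vs‖ := by
          refine (norm_add_le _ _).trans ?_
          rw [norm_smul, norm_smul, Real.norm_eq_abs, Real.norm_eq_abs]
      _ ≤ max |un w| |st w| * ‖vu‖ + max |un w| |st w| * ‖vs‖ := by
          gcongr
          exacts [le_max_left _ _, le_max_right _ _]
      _ = max |un w| |st w| * (‖vu‖ + ‖vs‖) := by ring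
      _ ≤ max |un w| |st w| * b := by gcongr
      _ = _ := mul_comm _ _

/-- A wavenumber as a real vector. -/
def realVec (k : Fin 2 → ℤ) : Fin 2 → ℝ := fun i => (k i : ℝ)

theorem norm_realVec (k : Fin 2 → ℤ) : ‖realVec k‖ = ‖k‖ := by
  refine le_antisymm ((pi_norm_le_iff_of_nonneg (norm_nonneg _)).2 fun i => ?_)
    ((pi_norm_le_iff_of_nonneg (norm_nonneg _)).2 fun i => ?_)
  · rw [realVec, Int.norm_cast_real]
    exact norm_le_pi_norm k i
  · rw [← Int.norm_cast_real]
    exact norm_le_pi_norm (realVec k) i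

theorem realVec_dualMap (A : Matrix (Fin 2) (Fin 2) ℤ) (k : Fin 2 → ℤ) :
    realVec (dualMap A k) = (A.map (Int.cast : ℤ → ℝ))ᵀ *ᵥ realVec k := by
  ext i
  rw [realVec, dualMap_apply]
  simp [Matrix.mulVec, dotProduct, Fin.sum_univ_two, realVec]

theorem realVec_sub (k l : Fin 2 → ℤ) : realVec (k - l) = realVec k - realVec l := by
  ext i
  simp [realVec]

theorem one_le_norm_of_ne_zero {k : Fin 2 → ℤ} (hk : k ≠ 0) : 1 ≤ ‖k‖ := by
  obtain ⟨i, hi⟩ := Function.ne_iff.1 hk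
  refine le_trans ?_ (norm_le_pi_norm k i)
  rw [Int.norm_eq_abs]
  exact_mod_cast Int.one_le_abs hi

theorem exists_norm_dualMap_le (A : Matrix (Fin 2) (Fin 2) ℤ) :
    ∃ H : ℝ, 0 ≤ H ∧ ∀ k, ‖dualMap A k‖ ≤ H * ‖k‖ := by
  refine ⟨‖LinearMap.toContinuousLinearMap (Matrix.toLin' (A.map (Int.cast : ℤ → ℝ))ᵀ)‖,
    norm_nonneg _, fun k => ?_⟩
  have := (LinearMap.toContinuousLinearMap
    (Matrix.toLin' (A.map (Int.cast : ℤ → ℝ))ᵀ)).le_opNorm (realVec k)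
  rwa [norm_realVec, show LinearMap.toContinuousLinearMap (Matrix.toLin'
    (A.map (Int.cast : ℤ → ℝ))ᵀ) (realVec k) = realVec (dualMap A k) from
    (realVec_dualMap A k).symm, norm_realVec] at this

namespace EigenCoords

variable {A : Matrix (Fin 2) (Fin 2) ℤ} {lam : ℝ} (E : EigenCoords A lam)

/-- The unstable coordinate of a wavenumber, in absolute value. -/
def u (k : Fin 2 → ℤ) : ℝ := |E.unst (realVec k)|

/-- The stable coordinate of a wavenumber, in absolute value. -/
def s (k : Fin 2 → ℤ) : ℝ := |E.stab (realVec k)|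

/-- The norm of a wavenumber adapted to the linear dynamics. -/
def adaptedNorm (k : Fin 2 → ℤ) : ℝ := max (E.u k) (E.s k)

theorem u_nonneg (k : Fin 2 → ℤ) : 0 ≤ E.u k := abs_nonneg _

theorem s_nonneg (k : Fin 2 → ℤ) : 0 ≤ E.s k := abs_nonneg _

theorem bd_pos : 0 < E.bd := one_pos.trans_le E.one_le_bd

theorem adaptedNorm_nonneg (k : Fin 2 → ℤ) : 0 ≤ E.adaptedNorm k :=
  (E.u_nonneg k).trans (le_max_left _ _)

theorem norm_le_adaptedNorm (k : Fin 2 → ℤ) : ‖k‖ ≤ E.bd * E.adaptedNorm k := by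
  rw [← norm_realVec]
  exact E.norm_le _

theorem adaptedNorm_le_norm (k : Fin 2 → ℤ) : E.adaptedNorm k ≤ E.bd * ‖k‖ := by
  rw [← norm_realVec]
  exact max_le (E.abs_unst_le _) (E.abs_stab_le _)

theorem abs_u_sub_le (k l : Fin 2 → ℤ) : |E.u l - lam * E.u k| ≤ E.bd * ‖l - dualMap A k‖ := by
  rw [u, u, ← E.abs_unst_mulVec, ← realVec_dualMap, ← norm_realVec, realVec_sub]
  exact (abs_abs_sub_abs_le_abs_sub _ _).trans (by rw [← map_sub]; exact E.abs_unst_le _)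

theorem abs_s_sub_le (k l : Fin 2 → ℤ) : |E.s l - lam⁻¹ * E.s k| ≤ E.bd * ‖l - dualMap A k‖ := by
  rw [s, s, ← E.abs_stab_mulVec, ← realVec_dualMap, ← norm_realVec, realVec_sub]
  exact (abs_abs_sub_abs_le_abs_sub _ _).trans (by rw [← map_sub]; exact E.abs_stab_le _)

open Classical in
/-- The square of the anisotropic weight, with the Euclidean norm replaced by the adapted one. -/
def weight (p : ℝ) (k : Fin 2 → ℤ) : ℝ :=
  if E.s k ≤ E.u k then E.adaptedNorm k ^ (2 * p) else E.adaptedNorm k ^ (-(2 * p))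

/-- Pairs of wavenumbers close to the graph of `k ↦ Aᵀ k`, away from the origin. -/
def Near (A : Matrix (Fin 2) (Fin 2) ℤ) (δ R : ℝ) (k l : Fin 2 → ℤ) : Prop :=
  R < ‖k‖ ∧ ‖l - dualMap A k‖ ≤ δ * ‖k‖

/-- Inside the cone `l` stays in the cone and is longer by `ν`, which raises the positive power.
Outside it, either `l` stays outside and is shorter by `ν`, which raises the negative power, or `l`
enters the cone, where its weight is large while that of `k` is small. In eigencoordinates no
multiplicative constant is lost. -/
theorem exists_weight_le_of_near (hlam : 1 < lam) {p ν : ℝ} (hp : 0 < p) (hν : 1 < ν)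
    (hνl : ν < lam) : ∃ δ R : ℝ, 0 < δ ∧ 0 < R ∧ ∀ k l, Near A δ R k l →
      E.weight p k ≤ ν ^ (-(2 * p)) * E.weight p l := by
  have hb := E.bd_pos
  have hlinv : 0 < lam⁻¹ := by positivity
  have hνinv : lam⁻¹ < ν⁻¹ := inv_strictAnti₀ (by linarith) hνl
  have hν1 : ν⁻¹ < 1 := inv_lt_one_of_one_lt₀ hν
  -- The three bounds serve, in order, the expansion of `u` by `ν`, the contraction of `s` by `ν⁻¹`,
  -- and a lower bound on `s l` when `l` enters the cone.
  obtain ⟨δ₀, hδ₀, hδ1, hδ2, hδ3⟩ : ∃ δ₀ : ℝ, 0 < δ₀ ∧ δ₀ ≤ lam - ν ∧ δ₀ ≤ ν⁻¹ - lam⁻¹ ∧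
      δ₀ ≤ lam⁻¹ / 2 :=
    ⟨min (min (lam - ν) (ν⁻¹ - lam⁻¹)) (lam⁻¹ / 2),
      lt_min (lt_min (by linarith) (by linarith)) (by linarith),
      (min_le_left _ _).trans (min_le_left _ _), (min_le_left _ _).trans (min_le_right _ _),
      min_le_right _ _⟩
  -- One factor `bd` comes from the coordinates of the error, the other from `‖k‖ ≤ bd * a`. The
  -- radius forces `a > 2 lam ^ 2`.
  refine ⟨δ₀ / E.bd ^ 2, E.bd * (2 * lam ^ 2), by positivity, by positivity,
    fun k l ⟨hR, hδ⟩ => ?_⟩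
  set a := E.adaptedNorm k with ha
  have hka := E.norm_le_adaptedNorm k
  have ha2 : 2 * lam ^ 2 < a := lt_of_mul_lt_mul_left (hR.trans_le hka) hb.le
  have ha0 : 0 < a := lt_of_le_of_lt (by positivity) ha2
  have herr : E.bd * ‖l - dualMap A k‖ ≤ δ₀ * a := by
    calc E.bd * ‖l - dualMap A k‖ ≤ E.bd * (δ₀ / E.bd ^ 2 * (E.bd * a)) := by
          refine mul_le_mul_of_nonneg_left (hδ.trans ?_) hb.le
          gcongr
      _ = δ₀ * a := by field_simp
  have hu := abs_le.1 ((E.abs_u_sub_le k l).trans herr)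
  have hs := abs_le.1 ((E.abs_s_sub_le k l).trans herr)
  have hul := E.u_nonneg l
  have hsl := E.s_nonneg l
  have hνr : ν ^ (-(2 * p)) * ν ^ (2 * p) = 1 := by
    rw [← Real.rpow_add (by linarith)]
    simp
  have hν0 : 0 < ν ^ (-(2 * p)) := Real.rpow_pos_of_pos (by linarith) _
  have hδa : δ₀ * a ≤ (lam - ν) * a := by gcongr
  have hδb : δ₀ * a ≤ (ν⁻¹ - lam⁻¹) * a := by gcongr
  have hδc : δ₀ * a ≤ lam⁻¹ / 2 * a := by gcongr
  have h2p : 0 ≤ 2 * p := by linarith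
  by_cases hk : E.s k ≤ E.u k
  · have hau : E.u k = a := (max_eq_left hk).symm
    have hsk : lam⁻¹ * E.s k ≤ lam⁻¹ * a := by
      rw [← hau]
      gcongr
    rw [hau] at hu
    have h1 : ν * a ≤ E.u l := by linarith [hu.1]
    have h2 : E.s l ≤ ν⁻¹ * a := by linarith [hs.2]
    have h3 : E.s l ≤ E.u l := by nlinarith
    rw [weight, weight, if_pos hk, if_pos h3]
    have h4 : ν * a ≤ E.adaptedNorm l := h1.trans (le_max_left _ _)
    calc a ^ (2 * p) = ν ^ (-(2 * p)) * (ν * a) ^ (2 * p) := by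
          rw [Real.mul_rpow (by linarith) ha0.le, ← mul_assoc, hνr, one_mul]
      _ ≤ _ := by gcongr
  · have has : E.s k = a := (max_eq_right (not_le.1 hk).le).symm
    rw [has] at hs
    rw [weight, if_neg hk, weight]
    by_cases hl : E.s l ≤ E.u l
    · rw [if_pos hl]
      have h1 : lam⁻¹ / 2 * a ≤ E.adaptedNorm l :=
        le_trans (by linarith [hs.1]) (le_max_right (E.u l) (E.s l))
      -- Crossing into the cone: the claim amounts to `2 lam ν ≤ a ^ 2`, which the choice of radius
      -- ensures.
      have h2 : a⁻¹ ≤ ν⁻¹ * (lam⁻¹ / 2 * a) := by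
        have h3 : ν⁻¹ * (lam⁻¹ / 2 * a) = a / (2 * lam * ν) := by
          field_simp
        rw [h3, le_div_iff₀ (by positivity), inv_mul_le_iff₀ ha0]
        have h4 : 2 * lam * ν ≤ 2 * lam ^ 2 := by nlinarith
        have h5 : 1 ≤ a := by nlinarith
        nlinarith
      calc a ^ (-(2 * p)) = (a⁻¹) ^ (2 * p) := by
            rw [Real.rpow_neg ha0.le, Real.inv_rpow ha0.le]
        _ ≤ (ν⁻¹ * (lam⁻¹ / 2 * a)) ^ (2 * p) := by gcongr
        _ = ν ^ (-(2 * p)) * (lam⁻¹ / 2 * a) ^ (2 * p) := by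
            rw [Real.mul_rpow (by positivity) (by positivity), Real.inv_rpow (by linarith),
              Real.rpow_neg (by linarith)]
        _ ≤ _ := by gcongr
    · rw [if_neg hl]
      have hal : E.adaptedNorm l = E.s l := max_eq_right (not_le.1 hl).le
      have hl0 : 0 < E.s l := lt_of_le_of_lt hul (not_le.1 hl)
      have h1 : E.s l ≤ ν⁻¹ * a := by linarith [hs.2]
      rw [hal]
      have h2 : ν * E.s l ≤ a := by
        have := mul_le_mul_of_nonneg_left h1 (show 0 ≤ ν by linarith)
        rwa [← mul_assoc, mul_inv_cancel₀ (by linarith), one_mul] at this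
      rw [← Real.mul_rpow (by linarith) hl0.le]
      exact Real.rpow_le_rpow_of_nonpos (by positivity) h2 (by linarith)

end EigenCoords

end PulsedDiffusion
end

noncomputable section
namespace PulsedDiffusion

/-! ### Comparison of weights and the one-step estimate -/

theorem rpow_neg_le_of_le_mul {x y C a : ℝ} (hx : 0 < x) (hC : 0 < C) (ha : 0 ≤ a)
    (h : x ≤ C * y) : y ^ (-a) ≤ C ^ a * x ^ (-a) := by
  have hy : 0 < y := pos_of_mul_pos_right (hx.trans_le h) hC.le
  have h1 : (C * y) ^ (-a) ≤ x ^ (-a) := Real.rpow_le_rpow_of_nonpos hx h (by linarith)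
  rw [Real.mul_rpow hC.le hy.le] at h1
  calc y ^ (-a) = C ^ a * (C ^ (-a) * y ^ (-a)) := by
        rw [← mul_assoc, ← Real.rpow_add hC]
        simp
    _ ≤ _ := by gcongr

theorem rpow_le_of_le_mul {x y C a : ℝ} (hx : 0 ≤ x) (hC : 0 ≤ C) (hy : 0 ≤ y) (ha : 0 ≤ a)
    (h : x ≤ C * y) : x ^ a ≤ C ^ a * y ^ a := by
  rw [← Real.mul_rpow hC hy]
  exact Real.rpow_le_rpow hx h ha

theorem norm_le_waveNorm (k : Fin 2 → ℤ) : ‖k‖ ≤ waveNorm k := by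
  refine (pi_norm_le_iff_of_nonneg (Real.sqrt_nonneg _)).2 fun i => ?_
  rw [Int.norm_eq_abs]
  refine Real.abs_le_sqrt ?_
  exact Finset.single_le_sum (f := fun i => (k i : ℝ) ^ 2) (fun i _ => sq_nonneg _)
    (Finset.mem_univ i)

theorem waveNorm_le_two_mul_norm (k : Fin 2 → ℤ) : waveNorm k ≤ 2 * ‖k‖ := by
  rw [waveNorm, Real.sqrt_le_left (by positivity), Fin.sum_univ_two]
  have h : ∀ i, (k i : ℝ) ^ 2 ≤ ‖k‖ ^ 2 := fun i => by
    rw [← sq_abs]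
    exact pow_le_pow_left₀ (abs_nonneg _) (abs_intCast_apply_le k i) 2
  nlinarith [h 0, h 1, sq_nonneg ‖k‖]

theorem one_le_waveNorm {k : Fin 2 → ℤ} (hk : k ≠ 0) : 1 ≤ waveNorm k :=
  (one_le_norm_of_ne_zero hk).trans (norm_le_waveNorm k)

theorem norm_le_bracket (k : Fin 2 → ℤ) : ‖k‖ ≤ bracket k := by
  unfold bracket
  linarith

namespace EigenCoords

variable {A : Matrix (Fin 2) (Fin 2) ℤ} {lam : ℝ} (E : EigenCoords A lam)

theorem ne_zero_of_not_le {k : Fin 2 → ℤ} (hk : ¬ E.s k ≤ E.u k) : k ≠ 0 := by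
  rintro rfl
  refine hk ?_
  have : realVec 0 = 0 := by
    ext i
    simp [realVec]
  simp [s, u, this]

theorem adaptedNorm_pos {k : Fin 2 → ℤ} (hk : k ≠ 0) : 0 < E.adaptedNorm k :=
  pos_of_mul_pos_right ((one_pos.trans_le (one_le_norm_of_ne_zero hk)).trans_le
    (E.norm_le_adaptedNorm k)) E.bd_pos.le

open Classical in
theorem sq_anisoWeight (p : ℝ) {k : Fin 2 → ℤ} (hk : k ≠ 0) : anisoWeight A p k ^ 2 =
    if E.s k ≤ E.u k then waveNorm k ^ (2 * p) else waveNorm k ^ (-(2 * p)) := by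
  have hx : 0 ≤ waveNorm k := Real.sqrt_nonneg _
  have hm : (fun i => (k i : ℝ)) ∈ unstableCone A ↔ E.s k ≤ E.u k := E.mem_cone_iff (realVec k)
  rw [anisoWeight, if_neg hk]
  simp only [hm]
  split_ifs
  · rw [← Real.rpow_mul_natCast hx]
    congr 1
    push_cast
    ring
  · rw [← Real.rpow_mul_natCast hx]
    congr 1
    push_cast
    ring

theorem weight_le_sq_anisoWeight {p : ℝ} (hp : 0 < p) {k : Fin 2 → ℤ} (hk : k ≠ 0) :
    E.weight p k ≤ (2 * E.bd) ^ (2 * p) * anisoWeight A p k ^ 2 := by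
  have hb := E.bd_pos
  have hx : 0 < waveNorm k := one_pos.trans_le (one_le_waveNorm hk)
  have hn := E.adaptedNorm_pos hk
  rw [E.sq_anisoWeight p hk, weight]
  split_ifs
  · refine rpow_le_of_le_mul hn.le (by positivity) hx.le (by positivity) ?_
    nlinarith [E.adaptedNorm_le_norm k, norm_le_waveNorm k]
  · refine rpow_neg_le_of_le_mul hx (by positivity) (by positivity) ?_
    nlinarith [E.norm_le_adaptedNorm k, waveNorm_le_two_mul_norm k]

theorem sq_anisoWeight_le_weight {p : ℝ} (hp : 0 < p) {k : Fin 2 → ℤ} (hk : k ≠ 0) :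
    anisoWeight A p k ^ 2 ≤ (2 * E.bd) ^ (2 * p) * E.weight p k := by
  have hb := E.bd_pos
  have hx : 0 < waveNorm k := one_pos.trans_le (one_le_waveNorm hk)
  have hn := E.adaptedNorm_pos hk
  rw [E.sq_anisoWeight p hk, weight]
  split_ifs
  · refine rpow_le_of_le_mul hx.le (by positivity) hn.le (by positivity) ?_
    nlinarith [E.norm_le_adaptedNorm k, waveNorm_le_two_mul_norm k]
  · refine rpow_neg_le_of_le_mul hn (by positivity) (by positivity) ?_
    nlinarith [E.adaptedNorm_le_norm k, norm_le_waveNorm k]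

theorem waveNorm_rpow_le_sq_anisoWeight (E : EigenCoords A lam) {p : ℝ} (hp : 0 < p) {k : Fin 2 → ℤ} (hk : k ≠ 0) :
    waveNorm k ^ (-(2 * p)) ≤ anisoWeight A p k ^ 2 := by
  rw [E.sq_anisoWeight p hk]
  split_ifs
  · exact Real.rpow_le_rpow_of_exponent_le (one_le_waveNorm hk) (by linarith)
  · exact le_rfl

theorem weight_le_bracket {p s : ℝ} (hp : 0 < p) (hs : p ≤ s) (k : Fin 2 → ℤ) :
    E.weight p k ≤ E.bd ^ (2 * p) * bracket k ^ (2 * s) := by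
  have hb := E.bd_pos
  have hJ := one_le_bracket k
  have hbp : 0 ≤ E.bd ^ (2 * p) := Real.rpow_nonneg hb.le _
  rw [weight]
  split_ifs with h
  · refine (rpow_le_of_le_mul (y := bracket k) (C := E.bd) (E.adaptedNorm_nonneg k) hb.le
      (bracket_pos k).le (by positivity) ((E.adaptedNorm_le_norm k).trans ?_)).trans ?_
    · exact mul_le_mul_of_nonneg_left (norm_le_bracket k) hb.le
    · gcongr
  · have hk := E.ne_zero_of_not_le h
    refine (rpow_neg_le_of_le_mul one_pos hb (by positivity)
      ((one_le_norm_of_ne_zero hk).trans (E.norm_le_adaptedNorm k))).trans ?_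
    rw [Real.one_rpow]
    gcongr
    exact Real.one_le_rpow hJ (by linarith)

end EigenCoords

/-- The square of the weight of the homogeneous Sobolev norm of order `-L`. -/
def sobolevWeight (L : ℝ) (k : Fin 2 → ℤ) : ℝ :=
  if k = 0 then 0 else waveNorm k ^ (-(2 * L))

/-- The weak order `p + 1` lies strictly beyond `p`, so high frequencies gain `|k|^{-2} ≤ θ` over
the anisotropic weight, while at the remaining frequencies `θ^{-L} |k|^{-2L} ≥ 1`. -/
theorem weakWeight_le_interpolation {A : Matrix (Fin 2) (Fin 2) ℤ} {lam : ℝ}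
    (E : EigenCoords A lam) {p L θ : ℝ} (hp : 0 < p) (hL : 0 < L) (hθ : 0 < θ)
    {k : Fin 2 → ℤ} (hk : k ≠ 0) :
    weakWeight (p + 1) k ≤ 2 ^ (2 * (p + 1)) * θ * anisoWeight A p k ^ 2 +
      2 ^ (2 * (p + 1)) * θ ^ (-L) * sobolevWeight L k := by
  set x := waveNorm k with hx
  have hx1 : 1 ≤ x := one_le_waveNorm hk
  have hx0 : 0 < x := by linarith
  have h1 : weakWeight (p + 1) k ≤ 2 ^ (2 * (p + 1)) * x ^ (-(2 * (p + 1))) := by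
    refine rpow_neg_le_of_le_mul hx0 two_pos (by positivity) ?_
    exact (waveNorm_le_two_mul_norm k).trans (by linarith [norm_le_bracket k])
  have h2 := E.waveNorm_rpow_le_sq_anisoWeight hp hk
  have h3 : x ^ (-(2 * (p + 1))) ≤ θ * x ^ (-(2 * p)) + θ ^ (-L) * x ^ (-(2 * L)) := by
    have hsplit : x ^ (-(2 * (p + 1))) = (x ^ 2)⁻¹ * x ^ (-(2 * p)) := by
      rw [show -(2 * (p + 1)) = -(2 : ℝ) + -(2 * p) by ring, Real.rpow_add hx0,
        Real.rpow_neg hx0.le, Real.rpow_two]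
    have hp0 : 0 ≤ x ^ (-(2 * p)) := Real.rpow_nonneg hx0.le _
    have hL0 : 0 ≤ θ ^ (-L) * x ^ (-(2 * L)) := by positivity
    rcases le_total ((x ^ 2)⁻¹) θ with h | h
    · rw [hsplit]
      exact (mul_le_mul_of_nonneg_right h hp0).trans (by linarith)
    · have h4 : θ ^ (-L) * x ^ (-(2 * L)) = (θ * x ^ 2) ^ (-L) := by
        rw [Real.mul_rpow hθ.le (by positivity), ← Real.rpow_natCast_mul hx0.le]
        congr 2
        push_cast
        ring
      have h5 : θ * x ^ 2 ≤ 1 := by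
        rwa [le_inv_comm₀ hθ (by positivity), ← one_div, le_div_iff₀ hθ, mul_comm] at h
      have h6 : 1 ≤ (θ * x ^ 2) ^ (-L) :=
        Real.one_le_rpow_of_pos_of_le_one_of_nonpos (by positivity) h5 (by linarith)
      have h7 : x ^ (-(2 * (p + 1))) ≤ 1 :=
        Real.rpow_le_one_of_one_le_of_nonpos hx1 (by linarith)
      rw [h4]
      have : 0 ≤ θ * x ^ (-(2 * p)) := by positivity
      linarith
  have h20 : (0 : ℝ) ≤ 2 ^ (2 * (p + 1)) := by positivity
  rw [sobolevWeight, if_neg hk, ← hx]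
  calc _ ≤ _ := h1
    _ ≤ 2 ^ (2 * (p + 1)) * (θ * x ^ (-(2 * p)) + θ ^ (-L) * x ^ (-(2 * L))) := by gcongr
    _ ≤ 2 ^ (2 * (p + 1)) * (θ * anisoWeight A p k ^ 2 + θ ^ (-L) * x ^ (-(2 * L))) := by gcongr
    _ = _ := by ring

theorem finite_near (A : Matrix (Fin 2) (Fin 2) ℤ) (δ R : ℝ) (k : Fin 2 → ℤ) :
    {l | EigenCoords.Near A δ R k l}.Finite := by
  refine Set.Finite.subset
    ((isCompact_closedBall (dualMap A k) (δ * ‖k‖)).finite_of_discrete) fun l hl => ?_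
  rw [Metric.mem_closedBall, dist_eq_norm]
  exact hl.2

/-- Near pairs satisfy `bracket l ≤ (1 + H + δ) * bracket k`, so one step multiplies the weak norm
at most by a constant. -/
theorem exists_weakWeight_le_of_near (A : Matrix (Fin 2) (Fin 2) ℤ) {δ R s : ℝ} (hδ : 0 < δ)
    (hs : 0 < s) : ∃ H : ℝ, 0 ≤ H ∧ ∀ k l, EigenCoords.Near A δ R k l →
      weakWeight s k ≤ H * weakWeight s l := by
  obtain ⟨H, hH, hA⟩ := exists_norm_dualMap_le A
  refine ⟨(1 + H + δ) ^ (2 * s), by positivity, fun k l hkl => ?_⟩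
  refine rpow_neg_le_of_le_mul (bracket_pos l) (by positivity) (by positivity) ?_
  have h1 : ‖l‖ ≤ ‖l - dualMap A k‖ + ‖dualMap A k‖ := by
    simpa using norm_add_le (l - dualMap A k) (dualMap A k)
  have h2 := hkl.2
  have h3 := hA k
  unfold bracket
  nlinarith [norm_nonneg k]

/-- Derivatives of order at most `r` bounded by `K`, and first derivatives `ε`-close to `A`. -/
def CloseTo (A : Matrix (Fin 2) (Fin 2) ℤ) (r : ℕ) (ε K : ℝ) (f : TorusMap) : Prop :=
  (∀ x, ‖iteratedFDeriv ℝ 1 f.lift x - iteratedFDeriv ℝ 1 (catMap A).lift x‖ ≤ ε) ∧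
    ∀ j, 1 ≤ j → j ≤ r → ∀ x, ‖iteratedFDeriv ℝ j f.lift x‖ ≤ K

/-- A pair fails to be near in two ways. If `‖w‖ > δ ‖k‖`, both brackets are `O(‖w‖)` and `2⌈q⌉₊`
integrations by parts give decay of order `q` in each index. Otherwise `k` and `l` are bounded and
`|M k l| ≤ 1` suffices. -/
theorem exists_far_entries_le (A : Matrix (Fin 2) (Fin 2) ℤ) {δ R : ℝ} (q K : ℝ) (hδ : 0 < δ)
    (hR : 0 < R) (hq : 0 < q) : ∃ D : ℝ, ∀ f : TorusMap,
      CloseTo A (2 * ⌈q⌉₊ + 1) (δ / 8) K f → ∀ k l, ¬ EigenCoords.Near A δ R k l →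
        ‖fourierMatrix f k l‖ ≤ D * (bracket k ^ (-q) * bracket l ^ (-q)) := by
  obtain ⟨H, hH, hA⟩ := exists_norm_dualMap_le A
  obtain ⟨C, hC, hf⟩ := exists_norm_fourierMatrix_le (2 * ⌈q⌉₊) K δ⁻¹
  set G : ℝ := 2 + (H + 1) * δ⁻¹ with hG
  have hδi : 0 < δ⁻¹ := inv_pos.2 hδ
  have hG0 : 0 < G := by positivity
  set G' : ℝ := (1 + R) * (1 + (H + δ) * R) with hG'
  have hG'0 : 0 < G' := by positivity
  refine ⟨C * (G ^ 2) ^ q + G' ^ q, fun f hfc k l hkl => ?_⟩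
  rw [← Real.mul_rpow (bracket_pos k).le (bracket_pos l).le]
  set w := l - dualMap A k with hw
  have hJ : 0 < bracket k * bracket l := mul_pos (bracket_pos k) (bracket_pos l)
  have hl : ‖l‖ ≤ ‖w‖ + ‖dualMap A k‖ := by
    simpa [hw] using norm_add_le (l - dualMap A k) (dualMap A k)
  have hk0 := norm_nonneg k
  have hAk := hA k
  have hJq : 0 ≤ (bracket k * bracket l) ^ (-q) := Real.rpow_nonneg hJ.le _
  have hGq : 0 ≤ C * (G ^ 2) ^ q := by positivity
  have hGq' : 0 ≤ G' ^ q := by positivity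
  by_cases hfar : δ * ‖k‖ < ‖w‖
  · have hw0 : 0 < ‖w‖ := lt_of_le_of_lt (by positivity) hfar
    have hw1 : 1 ≤ ‖w‖ := one_le_norm_of_ne_zero (norm_pos_iff.1 hw0)
    have hkw : ‖k‖ ≤ δ⁻¹ * ‖w‖ := by
      rw [inv_mul_eq_div, le_div_iff₀ hδ]
      linarith
    have hne : l ≠ dualMap A k := fun h => by simp [hw, h] at hw0
    have hM := hf A f (δ / 8) k l hfc.1 hfc.2 hne (by linarith) hkw
    have hbk : bracket k ≤ G * ‖w‖ := by
      have : 0 ≤ H * δ⁻¹ * ‖w‖ := by positivity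
      simp only [bracket, hG]
      nlinarith
    have hbl : bracket l ≤ G * ‖w‖ := by
      have : H * ‖k‖ ≤ H * (δ⁻¹ * ‖w‖) := by gcongr
      have : 0 ≤ δ⁻¹ * ‖w‖ := by positivity
      simp only [bracket, hG]
      nlinarith
    have hprod : bracket k * bracket l ≤ G ^ 2 * ‖w‖ ^ 2 := by
      calc _ ≤ (G * ‖w‖) * (G * ‖w‖) :=
            mul_le_mul hbk hbl (bracket_pos l).le (by positivity)
        _ = _ := by ring
    have hpow : ‖w‖⁻¹ ^ (2 * ⌈q⌉₊) ≤ (‖w‖ ^ 2) ^ (-q) := by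
      rw [inv_pow, pow_mul, ← Real.rpow_natCast (‖w‖ ^ 2), ← Real.rpow_neg (by positivity)]
      exact Real.rpow_le_rpow_of_exponent_le (one_le_pow₀ hw1) (neg_le_neg (Nat.le_ceil q))
    have hcmp := rpow_neg_le_of_le_mul (a := q) hJ (by positivity) hq.le hprod
    calc _ ≤ _ := hM
      _ ≤ C * ((G ^ 2) ^ q * (bracket k * bracket l) ^ (-q)) := by
          gcongr
          exact hpow.trans hcmp
      _ ≤ _ := by nlinarith [mul_nonneg hGq' hJq]
  · have hkR : ‖k‖ ≤ R := not_lt.1 fun h => hkl ⟨h, not_lt.1 hfar⟩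
    have hbk : bracket k ≤ 1 + R := by
      unfold bracket
      linarith
    have hbl : bracket l ≤ 1 + (H + δ) * R := by
      have : (H + δ) * ‖k‖ ≤ (H + δ) * R := by gcongr
      unfold bracket
      nlinarith [not_lt.1 hfar]
    have hprod : bracket k * bracket l ≤ G' * 1 := by
      rw [mul_one]
      exact mul_le_mul hbk hbl (bracket_pos l).le (by positivity)
    have hcmp := rpow_neg_le_of_le_mul (a := q) hJ hG'0 hq.le hprod
    rw [Real.one_rpow] at hcmp
    have := norm_fourierMatrix_le_one f k l
    nlinarith [mul_nonneg hGq hJq]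

/-- The action of `φ ↦ φ ∘ f⁻¹` on Fourier coefficients. -/
def fourierTransfer (f : TorusMap) (c : (Fin 2 → ℤ) → ℂ) (k : Fin 2 → ℤ) : ℂ :=
  ∑' l, fourierMatrix f k l * c l

/-- The layer-cake bound is used twice: with the adapted weight, where near pairs contract, and with
the weak weight, where they grow boundedly. In both cases the far entries cost a multiple of the
weak energy. -/
theorem exists_one_step_estimate {A : Matrix (Fin 2) (Fin 2) ℤ} {lam : ℝ}
    (E : EigenCoords A lam) (hlam : 1 < lam) {p ν : ℝ} (hp : 0 < p) (hν : 1 < ν) (hνl : ν < lam)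
    (K : ℝ) : ∃ ε C M : ℝ, 0 < ε ∧ 0 ≤ C ∧ 2 ≤ M ∧ ∀ f : TorusMap,
      MeasurePreserving f.toFun torusVol torusVol →
      CloseTo A (2 * ⌈p + 3⌉₊ + 1) ε K f →
      ∀ c : (Fin 2 → ℤ) → ℂ, energy (weakWeight (p + 1)) c ≠ ⊤ →
        (∀ k, Summable fun l => fourierMatrix f k l * c l) ∧
        energy (E.weight p) (fourierTransfer f c) ≤
          ENNReal.ofReal (ν ^ (-(2 * p))) * energy (E.weight p) c +
            ENNReal.ofReal C * energy (weakWeight (p + 1)) c ∧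
        energy (weakWeight (p + 1)) (fourierTransfer f c) ≤
          ENNReal.ofReal M * energy (weakWeight (p + 1)) c := by
  -- The gap between `ν` and `ν'` pays for the Young factor: `η` is chosen so that `(1 + η) ν'^{-2p}
  -- = ν^{-2p}`.
  obtain ⟨ν', hνν', hν'l⟩ := exists_between hνl
  have hν'0 : 0 < ν' := by linarith
  have hν0 : 0 < ν := by linarith
  obtain ⟨δ, R, hδ, hR, hW⟩ := E.exists_weight_le_of_near hlam hp (hν.trans hνν') hν'l
  obtain ⟨H, hH, hWk⟩ := exists_weakWeight_le_of_near A (R := R) hδ (show 0 < p + 1 by linarith)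
  obtain ⟨D, hD⟩ := exists_far_entries_le A (p + 3) K hδ hR (by linarith)
  obtain ⟨C₁, hC₁, hfar₁⟩ := exists_tsum_far_le (s := p + 1) (E.bd ^ (2 * p)) D
  obtain ⟨C₂, hC₂, hfar₂⟩ := exists_tsum_far_le (s := p + 1) 1 D
  set η : ℝ := (ν' / ν) ^ (2 * p) - 1 with hη
  have hη0 : 0 < η := by
    have : 1 < (ν' / ν) ^ (2 * p) :=
      Real.one_lt_rpow ((one_lt_div hν0).2 hνν') (by positivity)
    linarith
  have hην : (1 + η) * ν' ^ (-(2 * p)) = ν ^ (-(2 * p)) := by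
    rw [hη, add_sub_cancel, Real.div_rpow hν'0.le hν0.le, Real.rpow_neg hν'0.le,
      Real.rpow_neg hν0.le]
    have := (Real.rpow_pos_of_pos hν'0 (2 * p)).ne'
    field_simp
  have hηi : 0 ≤ 1 + η⁻¹ := by positivity
  refine ⟨δ / 8, (1 + η⁻¹) * C₁, 2 + ((1 + η) * H + (1 + η⁻¹) * C₂), by positivity,
    by positivity, by linarith [show 0 ≤ (1 + η) * H + (1 + η⁻¹) * C₂ by positivity],
    fun f hf hfc c hc => ?_⟩
  have hM : ∀ k l, ¬ EigenCoords.Near A δ R k l → ‖fourierMatrix f k l‖ ≤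
      D * (bracket k ^ (-(p + 1 + 2)) * bracket l ^ (-(p + 1 + 2))) := fun k l h => by
    have := hD f hfc k l h
    rwa [show -(p + 3) = -(p + 1 + 2) by ring] at this
  have hs : ∀ k, Summable fun l => fourierMatrix f k l * c l := fun k =>
    summable_mul_of_energy_weak k (finite_near A δ R k) (hM k) hc
  refine ⟨hs, ?_, ?_⟩
  · have h := energy_le_layercake (tsum_enorm_sq_fourierMatrix_le hf) hW hs hη0
    refine h.trans ?_
    rw [energy_const_mul (Real.rpow_nonneg hν'0.le _), ← mul_assoc,
      ← ENNReal.ofReal_mul (by positivity), hην, ENNReal.ofReal_mul hηi, mul_assoc]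
    gcongr
    exact hfar₁ _ _ _ _ (E.weight_le_bracket hp (by linarith)) hM
  · have h := energy_le_layercake (tsum_enorm_sq_fourierMatrix_le hf) hWk hs hη0
    refine h.trans ?_
    have hB : ∀ k, weakWeight (p + 1) k ≤ 1 * bracket k ^ (2 * (p + 1)) := fun k => by
      rw [one_mul]
      exact Real.rpow_le_rpow_of_exponent_le (one_le_bracket k) (by linarith)
    rw [energy_const_mul hH, ← mul_assoc, ← ENNReal.ofReal_mul (by positivity)]
    calc _ ≤ ENNReal.ofReal ((1 + η) * H) * energy (weakWeight (p + 1)) c +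
          ENNReal.ofReal (1 + η⁻¹) *
            (ENNReal.ofReal C₂ * energy (weakWeight (p + 1)) c) := by
          gcongr
          exact hfar₂ _ _ _ _ hB hM
      _ = ENNReal.ofReal ((1 + η) * H + (1 + η⁻¹) * C₂) * energy (weakWeight (p + 1)) c := by
          rw [ENNReal.ofReal_add (show 0 ≤ (1 + η) * H by positivity)
            (show 0 ≤ (1 + η⁻¹) * C₂ by positivity),
            ENNReal.ofReal_mul (p := 1 + η⁻¹) hηi]
          ring
      _ ≤ _ := mul_le_mul_left (ENNReal.ofReal_le_ofReal (by linarith)) _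

end PulsedDiffusion
end

noncomputable section
namespace PulsedDiffusion
open ENNReal

/-! ### The extended transfer operator and its iterates -/

/-- The square of the anisotropic weight. -/
def sqAnisoWeight (A : Matrix (Fin 2) (Fin 2) ℤ) (p : ℝ) (k : Fin 2 → ℤ) : ℝ :=
  anisoWeight A p k ^ 2

theorem sqAnisoWeight_nonneg (A : Matrix (Fin 2) (Fin 2) ℤ) (p : ℝ) (k : Fin 2 → ℤ) :
    0 ≤ sqAnisoWeight A p k := sq_nonneg _

theorem mem_HpZero_iff {A : Matrix (Fin 2) (Fin 2) ℤ} {p : ℝ} {c : (Fin 2 → ℤ) → ℂ} :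
    c ∈ HpZero A p ↔ c 0 = 0 ∧ energy (sqAnisoWeight A p) c ≠ ⊤ := by
  have h0 := sqAnisoWeight_nonneg A p
  have he : (fun k => (anisoWeight A p k * ‖c k‖) ^ 2) =
      fun k => sqAnisoWeight A p k * ‖c k‖ ^ 2 := funext fun k => mul_pow _ _ _
  change (c 0 = 0 ∧ Summable fun k => (anisoWeight A p k * ‖c k‖) ^ 2) ↔ _
  rw [he]
  refine and_congr_right fun _ => ⟨fun hs => ?_, summable_of_energy_ne_top h0⟩
  rw [energy_eq_ofReal h0 hs]
  exact ENNReal.ofReal_ne_top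

theorem energy_sqAnisoWeight {A : Matrix (Fin 2) (Fin 2) ℤ} {p : ℝ} (c : HpZero A p) :
    energy (sqAnisoWeight A p) c = ENNReal.ofReal (anisoNorm A p c ^ 2) := by
  have h0 := sqAnisoWeight_nonneg A p
  rw [energy_eq_ofReal h0 (summable_of_energy_ne_top h0 (mem_HpZero_iff.1 c.2).2), anisoNorm,
    Real.sq_sqrt (tsum_nonneg fun k => sq_nonneg _)]
  exact congrArg _ (tsum_congr fun k => (mul_pow _ _ _).symm)

theorem ne_zero_of_apply_ne_zero {c : (Fin 2 → ℤ) → ℂ} (hc : c 0 = 0) {k : Fin 2 → ℤ}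
    (hk : c k ≠ 0) : k ≠ 0 := fun h => hk (h ▸ hc)

theorem sobolevWeight_nonneg (L : ℝ) (k : Fin 2 → ℤ) : 0 ≤ sobolevWeight L k := by
  unfold sobolevWeight
  split_ifs
  · exact le_rfl
  · exact Real.rpow_nonneg (Real.sqrt_nonneg _) _

theorem energy_sobolevWeight_le {A : Matrix (Fin 2) (Fin 2) ℤ} {lam : ℝ} (E : EigenCoords A lam)
    {p L : ℝ} (hp : 0 < p) (hL : p < L) {c : (Fin 2 → ℤ) → ℂ} (hc : c 0 = 0) :
    energy (sobolevWeight L) c ≤ energy (sqAnisoWeight A p) c := by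
  refine energy_mono fun k hk => ?_
  have hk0 := ne_zero_of_apply_ne_zero hc hk
  rw [sobolevWeight, if_neg hk0]
  exact (Real.rpow_le_rpow_of_exponent_le (one_le_waveNorm hk0) (by linarith)).trans
    (E.waveNorm_rpow_le_sq_anisoWeight hp hk0)

theorem energy_sobolevWeight {A : Matrix (Fin 2) (Fin 2) ℤ} {lam : ℝ} (E : EigenCoords A lam)
    {p L : ℝ} (hp : 0 < p) (hL : p < L) (c : HpZero A p) :
    energy (sobolevWeight L) c = ENNReal.ofReal (sobolevNorm (-L) c ^ 2) := by
  obtain ⟨hc0, hc⟩ := mem_HpZero_iff.1 c.2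
  have hne := ((energy_sobolevWeight_le E hp hL hc0).trans_lt (lt_top_iff_ne_top.2 hc)).ne
  have he : ∀ k, (if k = 0 then 0 else (waveNorm k ^ (-L) * ‖(c : (Fin 2 → ℤ) → ℂ) k‖) ^ 2) =
      sobolevWeight L k * ‖(c : (Fin 2 → ℤ) → ℂ) k‖ ^ 2 := fun k => by
    unfold sobolevWeight
    split_ifs
    · simp
    · have hk : 0 ≤ waveNorm k := Real.sqrt_nonneg _
      rw [mul_pow, ← Real.rpow_mul_natCast hk]
      congr 2
      push_cast
      ring
  rw [energy_eq_ofReal (sobolevWeight_nonneg L)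
    (summable_of_energy_ne_top (sobolevWeight_nonneg L) hne), sobolevNorm,
    Real.sq_sqrt (tsum_nonneg fun k => by
      rw [he]
      exact mul_nonneg (sobolevWeight_nonneg L k) (sq_nonneg _))]
  exact congrArg _ (tsum_congr fun k => (he k).symm)

theorem energy_weakWeight_le {A : Matrix (Fin 2) (Fin 2) ℤ} {lam : ℝ} (E : EigenCoords A lam)
    {p L θ : ℝ} (hp : 0 < p) (hL : p < L) (hθ : 0 < θ) {c : (Fin 2 → ℤ) → ℂ} (hc : c 0 = 0) :
    energy (weakWeight (p + 1)) c ≤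
      ENNReal.ofReal (2 ^ (2 * (p + 1)) * θ) * energy (sqAnisoWeight A p) c +
      ENNReal.ofReal (2 ^ (2 * (p + 1)) * θ ^ (-L)) * energy (sobolevWeight L) c := by
  rw [← energy_const_mul (by positivity), ← energy_const_mul (by positivity),
    ← energy_add (fun k => mul_nonneg (by positivity) (sqAnisoWeight_nonneg A p k))
      (fun k => mul_nonneg (by positivity) (sobolevWeight_nonneg L k))]
  exact energy_mono fun k hk => weakWeight_le_interpolation E hp (hp.trans hL) hθ
    (ne_zero_of_apply_ne_zero hc hk)

/-- Makes the one-step estimate applicable to every element of the anisotropic space, not only to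
smooth functions. -/
theorem energy_weakWeight_ne_top {A : Matrix (Fin 2) (Fin 2) ℤ} {lam : ℝ}
    (E : EigenCoords A lam) {p : ℝ} (hp : 0 < p) {c : (Fin 2 → ℤ) → ℂ} (hc : c ∈ HpZero A p) :
    energy (weakWeight (p + 1)) c ≠ ⊤ := by
  obtain ⟨hc0, hc⟩ := mem_HpZero_iff.1 hc
  have hS := energy_sobolevWeight_le E hp (lt_add_one p) hc0
  refine ne_top_of_le_ne_top ?_ (energy_weakWeight_le E hp (lt_add_one p) one_pos hc0)
  exact ENNReal.add_ne_top.2 ⟨ENNReal.mul_ne_top ENNReal.ofReal_ne_top hc,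
    ENNReal.mul_ne_top ENNReal.ofReal_ne_top (ne_top_of_le_ne_top hc hS)⟩

theorem norm_heat_le {κ : ℝ} (hκ : 0 ≤ κ) (c : (Fin 2 → ℤ) → ℂ) (k : Fin 2 → ℤ) :
    ‖heat κ c k‖ ≤ ‖c k‖ := by
  rw [heat, norm_mul]
  refine mul_le_of_le_one_left (norm_nonneg _) ?_
  rw [Complex.norm_real, Real.norm_of_nonneg (Real.exp_pos _).le, Real.exp_le_one_iff]
  have : 0 ≤ κ * (4 * Real.pi ^ 2 * waveNorm k ^ 2) := by positivity
  linarith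

theorem fourierTransfer_zero (f : TorusMap) {c : (Fin 2 → ℤ) → ℂ} (hc : c 0 = 0) :
    fourierTransfer f c 0 = 0 := by
  rw [fourierTransfer]
  refine (tsum_congr fun l => ?_).trans tsum_zero
  by_cases hl : l = 0
  · rw [hl, hc, mul_zero]
  · rw [fourierMatrix_zero_left f hl, zero_mul]

/-- The operator `e^{κΔ} (φ ∘ f⁻¹)` on the anisotropic space. -/
def transferOp {A : Matrix (Fin 2) (Fin 2) ℤ} {p : ℝ} (κ : ℝ) (f : TorusMap)
    (hs : ∀ c ∈ HpZero A p, ∀ k, Summable fun l => fourierMatrix f k l * c l)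
    (hm : ∀ c ∈ HpZero A p, heat κ (fourierTransfer f c) ∈ HpZero A p) :
    Module.End ℂ (HpZero A p) where
  toFun c := ⟨heat κ (fourierTransfer f c), hm c c.2⟩
  map_add' c d := by
    ext k
    simp only [heat, fourierTransfer, Submodule.coe_add, Pi.add_apply, mul_add]
    rw [(hs c c.2 k).tsum_add (hs d d.2 k), mul_add]
  map_smul' z c := by
    ext k
    simp only [heat, fourierTransfer, Submodule.coe_smul, Pi.smul_apply, smul_eq_mul,
      RingHom.id_apply]
    simp only [mul_left_comm _ z, tsum_mul_left]

/-- With `a ≤ 1` and `M ≥ 2` the two weak contributions at each step fit into one more factor `M`,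
so no geometric sum appears. -/
theorem iterate_le_of_step_le {X : Type*} {T : X → X} {e w : X → ℝ≥0∞} {a C M : ℝ≥0∞}
    (ha : a ≤ 1) (hM : 2 ≤ M) (he : ∀ x, e (T x) ≤ a * e x + C * w x)
    (hw : ∀ x, w (T x) ≤ M * w x) (n : ℕ) (x : X) :
    e (T^[n] x) ≤ a ^ n * e x + C * (M ^ n * w x) ∧ w (T^[n] x) ≤ M ^ n * w x := by
  induction n with
  | zero => simp
  | succ n ih =>
    rw [Function.iterate_succ_apply']
    constructor
    · calc e (T (T^[n] x)) ≤ a * e (T^[n] x) + C * w (T^[n] x) := he _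
        _ ≤ a * (a ^ n * e x + C * (M ^ n * w x)) + C * (M ^ n * w x) := by
            gcongr
            exacts [ih.1, ih.2]
        _ = a ^ (n + 1) * e x + (a * (C * (M ^ n * w x)) + C * (M ^ n * w x)) := by ring
        _ ≤ a ^ (n + 1) * e x + (1 * (C * (M ^ n * w x)) + C * (M ^ n * w x)) := by gcongr
        _ = a ^ (n + 1) * e x + 2 * (C * (M ^ n * w x)) := by ring
        _ ≤ a ^ (n + 1) * e x + M * (C * (M ^ n * w x)) := by gcongr
        _ = _ := by ring
    · calc w (T (T^[n] x)) ≤ M * w (T^[n] x) := hw _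
        _ ≤ M * (M ^ n * w x) := by
            gcongr
            exact ih.2
        _ = _ := by ring

theorem EigenCoords.energy_weight_le {A : Matrix (Fin 2) (Fin 2) ℤ} {lam : ℝ}
    (E : EigenCoords A lam) {p : ℝ} (hp : 0 < p) {c : (Fin 2 → ℤ) → ℂ} (hc : c 0 = 0) :
    energy (E.weight p) c ≤
      ENNReal.ofReal ((2 * E.bd) ^ (2 * p)) * energy (sqAnisoWeight A p) c := by
  have hb := E.bd_pos
  rw [← energy_const_mul (by positivity)]
  exact energy_mono fun k hk => E.weight_le_sq_anisoWeight hp (ne_zero_of_apply_ne_zero hc hk)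

theorem EigenCoords.energy_sqAnisoWeight_le {A : Matrix (Fin 2) (Fin 2) ℤ} {lam : ℝ}
    (E : EigenCoords A lam) {p : ℝ} (hp : 0 < p) {c : (Fin 2 → ℤ) → ℂ} (hc : c 0 = 0) :
    energy (sqAnisoWeight A p) c ≤
      ENNReal.ofReal ((2 * E.bd) ^ (2 * p)) * energy (E.weight p) c := by
  have hb := E.bd_pos
  rw [← energy_const_mul (by positivity)]
  exact energy_mono fun k hk => E.sq_anisoWeight_le_weight hp (ne_zero_of_apply_ne_zero hc hk)

/-- Passing from a one-step estimate in an equivalent weight, with a fixed weak weight, to the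
iterated estimate in the anisotropic norm with a weaker Sobolev norm. -/
theorem exists_norm_pow_le {A : Matrix (Fin 2) (Fin 2) ℤ} {lam : ℝ} (E : EigenCoords A lam)
    {p L ν C M : ℝ} (hp : 0 < p) (hL : p < L) (hν : 1 < ν) (hC : 0 ≤ C) (hM : 2 ≤ M) :
    ∃ C₂ C₃ M' : ℝ, 0 < C₂ ∧ 0 < C₃ ∧ 0 < M' ∧ ∀ T : Module.End ℂ (HpZero A p),
      (∀ c : HpZero A p, energy (E.weight p) (T c) ≤
        ENNReal.ofReal (ν ^ (-(2 * p))) * energy (E.weight p) c +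
          ENNReal.ofReal C * energy (weakWeight (p + 1)) c) →
      (∀ c : HpZero A p, energy (weakWeight (p + 1)) (T c) ≤
        ENNReal.ofReal M * energy (weakWeight (p + 1)) c) →
      ∀ (n : ℕ) (c : HpZero A p), anisoNorm A p ((T ^ n) c) ≤
        C₂ * ν ^ (-((n : ℝ) * p)) * anisoNorm A p c + C₃ * M' ^ n * sobolevNorm (-L) c := by
  have hb := E.bd_pos
  have hν0 : 0 < ν := by linarith
  have hM0 : 0 < M := by linarith
  set a : ℝ := ν ^ (-(2 * p)) with ha
  have ha0 : 0 < a := Real.rpow_pos_of_pos hν0 _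
  have ha1 : a ≤ 1 := Real.rpow_le_one_of_one_le_of_nonpos hν.le (by linarith)
  set Q : ℝ := (2 * E.bd) ^ (2 * p) with hQ
  have hQ0 : 0 < Q := by positivity
  set S : ℝ := 2 ^ (2 * (p + 1)) with hS
  have hS0 : 0 < S := by positivity
  set B : ℝ := M * (a / M) ^ (-L) with hB
  have hB0 : 0 < B := by positivity
  -- Square roots because energies are squared norms; the `+ 1` keeps `C₃` positive when `C = 0`.
  refine ⟨Real.sqrt (Q * (Q + C * S)), Real.sqrt (Q * C * S + 1), Real.sqrt B, by positivity,
    by positivity, by positivity, fun T hT1 hT2 n c => ?_⟩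
  -- The interpolation parameter depends on `n`: it makes `M ^ n * θ = a ^ n`, so the growth of the
  -- weak norm is absorbed at the contraction rate. The price `M ^ n * θ ^ (-L) = B ^ n` is still
  -- geometric.
  set θ : ℝ := (a / M) ^ n with hθ
  have hθ0 : 0 < θ := by positivity
  have hMθ : M ^ n * θ = a ^ n := by
    rw [hθ, ← mul_pow]
    congr 1
    field_simp
  have hMθL : M ^ n * θ ^ (-L) = B ^ n := by
    rw [hθ, hB, mul_pow, ← Real.rpow_natCast_mul (by positivity),
      ← Real.rpow_mul_natCast (by positivity), mul_comm (-L)]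
  have hc0 := (mem_HpZero_iff.1 c.2).1
  have hTc0 := (mem_HpZero_iff.1 ((T ^ n) c).2).1
  have hiter := (iterate_le_of_step_le (T := T) (e := fun c : HpZero A p => energy (E.weight p) c)
    (w := fun c : HpZero A p => energy (weakWeight (p + 1)) c)
    (by rw [← ENNReal.ofReal_one]; exact ENNReal.ofReal_le_ofReal ha1)
    (by rw [← ENNReal.ofReal_ofNat]; exact ENNReal.ofReal_le_ofReal hM) hT1 hT2 n c).1
  rw [← Module.End.pow_apply] at hiter
  set x := anisoNorm A p c with hx
  set y := anisoNorm A p ((T ^ n) c) with hy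
  set z := sobolevNorm (-L) c with hz
  have hx0 : 0 ≤ x := Real.sqrt_nonneg _
  have hz0 : 0 ≤ z := Real.sqrt_nonneg _
  have key : ENNReal.ofReal (y ^ 2) ≤ ENNReal.ofReal
      (Q * (a ^ n * (Q * x ^ 2) + C * (M ^ n * (S * θ * x ^ 2 + S * θ ^ (-L) * z ^ 2)))) := by
    rw [hy, ← energy_sqAnisoWeight]
    calc _ ≤ _ := E.energy_sqAnisoWeight_le hp hTc0
      _ ≤ ENNReal.ofReal Q * (ENNReal.ofReal a ^ n * (ENNReal.ofReal Q * ENNReal.ofReal (x ^ 2)) +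
          ENNReal.ofReal C * (ENNReal.ofReal M ^ n * (ENNReal.ofReal (S * θ) *
            ENNReal.ofReal (x ^ 2) + ENNReal.ofReal (S * θ ^ (-L)) * ENNReal.ofReal (z ^ 2)))) := by
          refine mul_le_mul_right (hiter.trans ?_) _
          rw [hx, hz, ← energy_sqAnisoWeight, ← energy_sobolevWeight E hp hL]
          gcongr
          · exact E.energy_weight_le hp hc0
          · exact energy_weakWeight_le E hp hL hθ0 hc0
      _ = _ := by
          rw [← ENNReal.ofReal_pow ha0.le, ← ENNReal.ofReal_pow hM0.le,
            ← ENNReal.ofReal_mul hQ0.le, ← ENNReal.ofReal_mul (by positivity),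
            ← ENNReal.ofReal_mul (by positivity), ← ENNReal.ofReal_mul (by positivity),
            ← ENNReal.ofReal_add (by positivity) (by positivity),
            ← ENNReal.ofReal_mul (by positivity), ← ENNReal.ofReal_mul hC,
            ← ENNReal.ofReal_add (by positivity) (by positivity), ← ENNReal.ofReal_mul hQ0.le]
  rw [ENNReal.ofReal_le_ofReal_iff (by positivity)] at key
  have key2 : y ^ 2 ≤ Q * (Q + C * S) * a ^ n * x ^ 2 + (Q * C * S + 1) * B ^ n * z ^ 2 := by
    refine key.trans ?_
    have h1 : Q * (a ^ n * (Q * x ^ 2) + C * (M ^ n * (S * θ * x ^ 2 + S * θ ^ (-L) * z ^ 2))) =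
        Q * (Q * a ^ n + C * S * (M ^ n * θ)) * x ^ 2 +
          Q * C * S * (M ^ n * θ ^ (-L)) * z ^ 2 := by ring
    rw [h1, hMθ, hMθL]
    have h2 : 0 ≤ B ^ n * z ^ 2 := by positivity
    linarith
  have hνa : (ν ^ (-((n : ℝ) * p))) ^ 2 = a ^ n := by
    rw [ha, ← Real.rpow_mul_natCast hν0.le, ← Real.rpow_mul_natCast hν0.le]
    congr 1
    push_cast
    ring
  have hνn : 0 ≤ ν ^ (-((n : ℝ) * p)) := Real.rpow_nonneg hν0.le _
  refine le_of_sq_le_sq ?_ (by positivity)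
  refine key2.trans ?_
  have h1 : (Real.sqrt (Q * (Q + C * S)) * ν ^ (-((n : ℝ) * p)) * x) ^ 2 =
      Q * (Q + C * S) * a ^ n * x ^ 2 := by
    rw [mul_pow, mul_pow, hνa, Real.sq_sqrt (by positivity)]
  have h2 : (Real.sqrt (Q * C * S + 1) * Real.sqrt B ^ n * z) ^ 2 =
      (Q * C * S + 1) * B ^ n * z ^ 2 := by
    rw [mul_pow, mul_pow, ← pow_mul, mul_comm n 2, pow_mul, Real.sq_sqrt hB0.le,
      Real.sq_sqrt (by positivity)]
  rw [← h1, ← h2, add_sq]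
  have : 0 ≤ 2 * (Real.sqrt (Q * (Q + C * S)) * ν ^ (-((n : ℝ) * p)) * x) *
      (Real.sqrt (Q * C * S + 1) * Real.sqrt B ^ n * z) := by positivity
  linarith

/-- Common core of both statements: all constants depend on `f` only through the derivative bound
`K`, and `K` is given before `ε`. -/
theorem exists_lasotaYorke {A : Matrix (Fin 2) (Fin 2) ℤ} (hA : IsHyperbolic A) {lam : ℝ}
    (hlam : IsExpansionRate A lam) {p L ν : ℝ} (hp : 0 < p) (hL : p < L) (hν : 1 < ν)
    (hνl : ν < lam) (K : ℝ) : ∃ ε C₂ C₃ M : ℝ, 0 < ε ∧ 0 < C₂ ∧ 0 < C₃ ∧ 0 < M ∧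
      ∀ (κ : ℝ) (f : TorusDiffeo), 0 ≤ κ → MeasurePreserving f.toFun torusVol torusVol →
        CloseTo A (2 * ⌈p + 3⌉₊ + 1) ε K f.toTorusMap → LasotaYorke A p L ν κ C₂ C₃ M f := by
  obtain ⟨E⟩ := nonempty_eigenCoords hA hlam
  obtain ⟨ε, C, M, hε, hC, hM, hstep⟩ := exists_one_step_estimate E hlam.1 hp hν hνl K
  obtain ⟨C₂, C₃, M', hC₂, hC₃, hM', hpow⟩ := exists_norm_pow_le E hp hL hν hC hM
  refine ⟨ε, C₂, C₃, M', hε, hC₂, hC₃, hM', fun κ f hκ hf hfc => ?_⟩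
  have hst : ∀ c ∈ HpZero A p, _ := fun c hc =>
    hstep f.toTorusMap hf hfc c (energy_weakWeight_ne_top E hp hc)
  have hheat : ∀ (W : (Fin 2 → ℤ) → ℝ) (c : (Fin 2 → ℤ) → ℂ),
      energy W (heat κ (fourierTransfer f.toTorusMap c)) ≤
        energy W (fourierTransfer f.toTorusMap c) :=
    fun W c => energy_le_of_norm_le W (norm_heat_le hκ _)
  have hmem : ∀ c ∈ HpZero A p, heat κ (fourierTransfer f.toTorusMap c) ∈ HpZero A p :=
    fun c hc => by
    have h0 : heat κ (fourierTransfer f.toTorusMap c) 0 = 0 := by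
      rw [heat, fourierTransfer_zero _ (mem_HpZero_iff.1 hc).1, mul_zero]
    refine mem_HpZero_iff.2 ⟨h0, ne_top_of_le_ne_top ?_ (E.energy_sqAnisoWeight_le hp h0)⟩
    refine ENNReal.mul_ne_top ENNReal.ofReal_ne_top
      (ne_top_of_le_ne_top ?_ ((hheat _ c).trans (hst c hc).2.1))
    exact ENNReal.add_ne_top.2 ⟨ENNReal.mul_ne_top ENNReal.ofReal_ne_top
      (ne_top_of_le_ne_top (ENNReal.mul_ne_top ENNReal.ofReal_ne_top (mem_HpZero_iff.1 hc).2)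
        (E.energy_weight_le hp (mem_HpZero_iff.1 hc).1)),
      ENNReal.mul_ne_top ENNReal.ofReal_ne_top (energy_weakWeight_ne_top E hp hc)⟩
  set T := transferOp κ f.toTorusMap (fun c hc => (hst c hc).1) hmem with hT
  have hpowT := hpow T (fun c => (hheat _ c).trans (hst c c.2).2.1)
    (fun c => (hheat _ c).trans (hst c c.2).2.2)
  -- Boundedness is the case `n = 1`, since `H^{-L}` is dominated by the anisotropic norm on
  -- mean-zero families.
  refine ⟨T, ⟨⟨C₂ * ν ^ (-(((1 : ℕ) : ℝ) * p)) + C₃ * M' ^ 1, fun c => ?_⟩,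
    fun φ c hφ hcφ => ?_⟩, fun n _ c => hpowT n c⟩
  · have h1 := hpowT 1 c
    rw [pow_one] at h1
    have h2 : sobolevNorm (-L) c ≤ anisoNorm A p c := by
      have := energy_sobolevWeight_le E hp hL (mem_HpZero_iff.1 c.2).1
      rw [energy_sobolevWeight E hp hL, energy_sqAnisoWeight,
        ENNReal.ofReal_le_ofReal_iff (sq_nonneg _)] at this
      exact le_of_sq_le_sq this (Real.sqrt_nonneg _)
    calc _ ≤ _ := h1
      _ ≤ C₂ * ν ^ (-(((1 : ℕ) : ℝ) * p)) * anisoNorm A p c + C₃ * M' ^ 1 * anisoNorm A p c := by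
          gcongr
      _ = _ := by ring
  · change heat κ (fourierTransfer f.toTorusMap c) = _
    congr 1
    funext k
    rw [hcφ]
    exact (hasSum_fourierMatrix_mul_mFourierCoeff hf hφ.continuous k).tsum_eq

/-! ### Uniform derivative bounds from the distances, and conclusion -/

/-- The reference map `g` supplies the high derivatives while `A` supplies the first. The bound `K`
is independent of `ε`, so `ε` may be chosen after it. -/
theorem exists_closeTo_of_ckDist_le (A : Matrix (Fin 2) (Fin 2) ℤ) (g : TorusMap) (r : ℕ)
    (Chat : ℝ) : ∃ K : ℝ, ∀ (ε : ℝ) (f : TorusMap), ckDist 1 f (catMap A) ≤ ε →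
      ckDist r f g ≤ Chat → CloseTo A r ε K f := by
  choose B hB using g.exists_norm_iteratedFDeriv_lift_le
  refine ⟨Chat + ∑ j ∈ Finset.range r, |B j|, fun ε f h1 h2 =>
    ⟨fun x => (norm_iteratedFDeriv_sub_le_ckDist f (catMap A) le_rfl le_rfl x).trans h1,
      fun j hj hjr x => ?_⟩⟩
  obtain ⟨i, rfl⟩ : ∃ i, j = i + 1 := ⟨j - 1, by omega⟩
  have h3 := (norm_iteratedFDeriv_sub_le_ckDist f g hj hjr x).trans h2
  have h4 : ‖iteratedFDeriv ℝ (i + 1) g.lift x‖ ≤ ∑ j ∈ Finset.range r, |B j| :=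
    ((hB i x).trans (le_abs_self _)).trans (Finset.single_le_sum (f := fun j => |B j|)
      (fun _ _ => abs_nonneg _) (Finset.mem_range.2 (by omega)))
  have h5 := norm_add_le (iteratedFDeriv ℝ (i + 1) f.lift x - iteratedFDeriv ℝ (i + 1) g.lift x)
    (iteratedFDeriv ℝ (i + 1) g.lift x)
  rw [sub_add_cancel] at h5
  linarith

end PulsedDiffusion
end

theorem mainTheorem6 (A : Matrix (Fin 2) (Fin 2) ℤ) (hA : PulsedDiffusion.IsHyperbolic A)
    (lam : ℝ) (hlam : PulsedDiffusion.IsExpansionRate A lam) (p : ℝ) (hp : 0 < p) :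
    (∀ L ν : ℝ, p < L → 1 < ν → ν < lam →
      ∃ ε C₂ C₃ M : ℝ, 0 < ε ∧ 0 < C₂ ∧ 0 < C₃ ∧ 0 < M ∧
        ∀ (κ : ℝ) (f : PulsedDiffusion.TorusDiffeo), 0 ≤ κ →
          MeasurePreserving f.toFun PulsedDiffusion.torusVol PulsedDiffusion.torusVol →
          PulsedDiffusion.cInfDist f.toTorusMap (PulsedDiffusion.catMap A) < ε →
          PulsedDiffusion.LasotaYorke A p L ν κ C₂ C₃ M f) ∧
    (∃ r : ℕ, ∀ L ν Chat : ℝ, p < L → 1 < ν → ν < lam → 0 < Chat →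
      ∃ ε C₂ C₃ M : ℝ, 0 < ε ∧ 0 < C₂ ∧ 0 < C₃ ∧ 0 < M ∧
        ∀ (κ : ℝ) (f : PulsedDiffusion.TorusDiffeo), 0 ≤ κ →
          MeasurePreserving f.toFun PulsedDiffusion.torusVol PulsedDiffusion.torusVol →
          PulsedDiffusion.ckDist 1 f.toTorusMap (PulsedDiffusion.catMap A) < ε →
          PulsedDiffusion.ckDist r f.toTorusMap PulsedDiffusion.idMap ≤ Chat →
          PulsedDiffusion.LasotaYorke A p L ν κ C₂ C₃ M f) := by
  open PulsedDiffusion in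
  -- The order `2⌈p + 3⌉₊ + 1` is the decay `s + 2` at `s = p + 1`, required in both indices, plus
  -- one derivative in the phase; it does not involve `L` or `ν`.
  refine ⟨fun L ν hL hν hνl => ?_, 2 * ⌈p + 3⌉₊ + 1, fun L ν Chat hL hν hνl _ => ?_⟩
  · set r := 2 * ⌈p + 3⌉₊ + 1 with hr
    obtain ⟨K, hK⟩ := exists_closeTo_of_ckDist_le A (catMap A) r 1
    obtain ⟨ε, C₂, C₃, M, hε, hC₂, hC₃, hM, h⟩ := exists_lasotaYorke hA hlam hp hL hν hνl K
    -- The first radius makes the `C^1` distance less than `ε`; the second makes the `C^r` distance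
    -- to `catMap A` less than `1`, which bounds the high derivatives.
    refine ⟨min ((2 : ℝ)⁻¹ ^ 1 * (ε / (1 + ε))) ((2 : ℝ)⁻¹ ^ r * (1 / (1 + 1))), C₂, C₃, M,
      by positivity, hC₂, hC₃, hM, fun κ f hκ hf hd => h κ f hκ hf ?_⟩
    exact hK ε _ (ckDist_lt_of_cInfDist_lt 1 hε (hd.trans_le (min_le_left _ _))).le
      (ckDist_lt_of_cInfDist_lt r one_pos (hd.trans_le (min_le_right _ _))).le
  · obtain ⟨K, hK⟩ := exists_closeTo_of_ckDist_le A idMap (2 * ⌈p + 3⌉₊ + 1) Chat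
    obtain ⟨ε, C₂, C₃, M, hε, hC₂, hC₃, hM, h⟩ := exists_lasotaYorke hA hlam hp hL hν hνl K
    exact ⟨ε, C₂, C₃, M, hε, hC₂, hC₃, hM, fun κ f hκ hf h1 h2 =>
      h κ f hκ hf (hK ε _ h1.le h2)⟩
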